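/- For $\epsilon>0$ with $\epsilon+\epsilon^3<1$ let $\pi$ be the distribution on $\mathcal X=\{1,2,3,4\}$ with $$\pi(\{1\})=\epsilon,\qquad \pi(\{2\})=\epsilon^3,\qquad \pi(\{3\})=\pi(\{4\})=\tfrac{1-\epsilon-\epsilon^3}{2}.$$ For $\gamma\in\Gamma=\{1,2\}$ let $P_\gamma$ be the Metropolis kernel on $\mathcal X$ with target $\pi$ and proposal $Q_\gamma(x,\cdot)$, where $Q_1(x,\cdot)$ is uniform on $\{x-1,x+1\}$ and $Q_2(x,\cdot)$ is uniform on $\{x-2,x-1,x+1,x+2\}$: a proposal $y\in\mathcal X$ from $x$ is accepted with probability $\min\{1,\pi(\{y\})/\pi(\{x\})\}$, and a proposal outside $\mathcal X$ is always rejected; after a rejection the chain stays at $x$. Consider the adaptive chain $(X_n)_{n\ge 0}$ produced as follows. Start with $X_0=X_1=X_2=1$ and $\gamma_2=1$. For $k=1,2,3,\dots$ do the following. 1. Sample $X_{2^{k^2}+1}\sim P_{\gamma_{2^{k^2}}}(X_{2^{k^2}},\cdot)$. 2. If $\gamma_{2^{k^2}}=1$, set $\gamma_{2^{(k+1)^2}}=2$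 if $X_{2^{k^2}+1}\ne X_{2^{k^2}}$ and $\gamma_{2^{(k+1)^2}}=1$ otherwise. If $\gamma_{2^{k^2}}=2$, set $\gamma_{2^{(k+1)^2}}=1$ if $X_{2^{k^2}+1}=1$ and $\gamma_{2^{(k+1)^2}}=2$ otherwise. 3. For $2^{k^2}+2\le n\le 2^{(k+1)^2}$ sample $X_n\sim P_{\gamma_{2^{(k+1)^2}}}(X_{n-1},\cdot)$. Then the following hold. (a) For every $\epsilon>0$ with $\epsilon+\epsilon^3<1$, the kernels $P_1$ and $P_2$ are $\pi$-invariant, $\pi$-irreducible and aperiodic, and there is a set $C\subseteq\mathcal X$ with $\pi(C)>0$ for which the following two conditions hold. * (Simultaneous minorisation.) There are a probability measure $\nu$ on $\mathcal X$ and a constant $\delta>0$ such that $P_\gamma(x,\cdot)\ge\delta\,\nu(\cdot)$ for all $x\in C$ and $\gamma\in\Gamma$. * (Simultaneous geometric drift.) There are a function $V:\mathcal X\to[1,\infty)$ and constants $0<\lambda<1$ and $b<\infty$ such that $P_\gamma V\le\lambda V+b\,I_C$ for all $\gamma\in\Gamma$. (b) For every $\epsilon>0$ with $\epsilon+\epsilon^3<1$,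 the strong law of large numbers holds: for every $f:\mathcal X\to\mathbb R$, almost surely $$\frac1N\sum_{i=0}^{N-1}f(X_i)\longrightarrow\sum_{x\in\mathcal X}f(x)\,\pi(\{x\})\qquad(N\to\infty).$$ (c) There is $\epsilon_0>0$ such that, for every $\epsilon\in(0,\epsilon_0)$ with $\epsilon+\epsilon^3<1$, the chain $(X_n)$ does not converge in distribution: there is no probability measure $\mu$ on $\mathcal X$ (in particular $\mu=\pi$ fails) such that $\lim_{n\to\infty}\mathbb P(X_n\in A)=\mu(A)$ for every $A\subseteq\mathcal X$. -/

import Mathlib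

open MeasureTheory ProbabilityTheory Filter Topology

namespace AirMCMC

section General

variable {S G : Type*} [MeasurableSpace S]

/-- Aperiodicity of a kernel with respect to a reference measure `φ` (for a `φ`-irreducible,
`φ`-invariant kernel this is the usual notion): there is no `d`-cycle with `d ≥ 2`, that is, no
pairwise disjoint measurable sets `D i`, indexed cyclically by `ZMod d`, which cover the space up
to a `φ`-null set and which the kernel maps one into the next with probability one. -/
def IsAperiodic (φ : Measure S) (κ : Kernel S S) : Prop :=
  ∀ d : ℕ, 2 ≤ d → ¬ ∃ D : ZMod d → Set S,
    (∀ i, MeasurableSet (D i)) ∧ Pairwise (fun i j => Disjoint (D i) (D j)) ∧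
    (∀ i, ∀ x ∈ D i, κ x (D (i + 1)) = 1) ∧ φ (⋃ i, D i)ᶜ = 0

/-- Simultaneous one-step minorisation: `P γ x ≥ δ • ν` for all `x ∈ C` and all `γ`, where
`π C > 0`, `δ > 0` and `ν` is a probability measure. -/
def SimultaneousMinorisation (π : Measure S) (P : G → Kernel S S) (C : Set S) : Prop :=
  MeasurableSet C ∧ 0 < π C ∧
    ∃ (ν : Measure S) (δ : ℝ), IsProbabilityMeasure ν ∧ 0 < δ ∧
      ∀ γ : G, ∀ x ∈ C, ENNReal.ofReal δ • ν ≤ P γ x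

/-- The standing regularity and small set assumption on a family of kernels. -/
structure RegularAndSmallSet (π : Measure S) (P : G → Kernel S S) (C : Set S) : Prop where
  invariant : ∀ γ, (P γ).Invariant π
  irreducible : ∀ γ, (P γ).IsIrreducible π
  aperiodic : ∀ γ, IsAperiodic π (P γ)
  minorisation : SimultaneousMinorisation π P C

/-- Simultaneous geometric drift `P γ V ≤ lam V + b 1_C`, with `V ≥ 1` and `0 < lam < 1`. -/
def SimultaneousGeometricDrift (P : G → Kernel S S) (C : Set S) : Prop :=
  ∃ (V : S → ℝ) (lam b : ℝ), Measurable V ∧ (∀ x, 1 ≤ V x) ∧ 0 < lam ∧ lam < 1 ∧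
    ∀ γ x, ∫⁻ y, ENNReal.ofReal (V y) ∂(P γ x)
      ≤ ENNReal.ofReal (lam * V x + b * C.indicator (fun _ => 1) x)

/-- The laws of `X 0, X 1, …` under `μ` converge to some probability measure, setwise. -/
def ConvergesInDistribution {Ω : Type*} [MeasurableSpace Ω] (μ : Measure Ω) (X : ℕ → Ω → S) :
    Prop :=
  ∃ ν : Measure S, IsProbabilityMeasure ν ∧
    ∀ A, MeasurableSet A → Tendsto (fun n => μ (X n ⁻¹' A)) atTop (𝓝 (ν A))

end General

/-! ### The two Metropolis kernels on four points -/

/-- The state space `{1, 2, 3, 4}`; the index `i : Fin 4` stands for the point `i + 1`. -/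
abbrev State : Type := Fin 4

/-- The parameter set `{1, 2}`; the index `0` stands for `1` and the index `1` for `2`. -/
abbrev Param : Type := Fin 2

/-- The values of `ε` for which the target below is a distribution with full support. -/
structure Admissible (ε : ℝ) : Prop where
  pos : 0 < ε
  lt_one : ε + ε ^ 3 < 1

/-- Weights of the target: `ε, ε³, (1 - ε - ε³)/2, (1 - ε - ε³)/2` at the points `1, 2, 3, 4`. -/
noncomputable def weight (ε : ℝ) : State → ℝ :=
  ![ε, ε ^ 3, (1 - ε - ε ^ 3) / 2, (1 - ε - ε ^ 3) / 2]

/-- Probability that the proposal from `x` is `y`, for integers `x`, `y`: uniform on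
`{x - 1, x + 1}` for the first parameter, on `{x - 2, x - 1, x + 1, x + 2}` for the second. -/
noncomputable def proposal (g : Param) (x y : ℤ) : ℝ :=
  if g = 0 then (if |y - x| = 1 then 1 / 2 else 0)
  else (if |y - x| = 1 ∨ |y - x| = 2 then 1 / 4 else 0)

/-- Probability that the point `y ≠ x` of the state space is proposed from `x` and accepted. -/
noncomputable def moveProb (ε : ℝ) (g : Param) (x y : State) : ℝ :=
  proposal g ((x : ℕ) : ℤ) ((y : ℕ) : ℤ) * min 1 (weight ε y / weight ε x)

/-- Metropolis transition probabilities. The remaining mass stays at `x`; it includes all proposals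
outside the state space, which are always rejected. -/
noncomputable def transProb (ε : ℝ) (g : Param) (x y : State) : ℝ :=
  if y = x then 1 - ∑ z ∈ Finset.univ.erase x, moveProb ε g x z else moveProb ε g x y

theorem weight_pos {ε : ℝ} (h : Admissible ε) (x : State) : 0 < weight ε x := by
  have h1 := h.pos
  have h2 := h.lt_one
  have h3 : 0 < ε ^ 3 := by positivity
  fin_cases x <;> simp [weight] <;> linarith

theorem sum_weight (ε : ℝ) : ∑ x, weight ε x = 1 := by
  simp [weight, Fin.sum_univ_four]
  ring

theorem proposal_nonneg (g : Param) (x y : ℤ) : 0 ≤ proposal g x y := by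
  unfold proposal
  split_ifs <;> norm_num

theorem sum_proposal_le (g : Param) (x : State) :
    ∑ z ∈ Finset.univ.erase x, proposal g ((x : ℕ) : ℤ) ((z : ℕ) : ℤ) ≤ 1 := by
  refine (Finset.sum_le_sum_of_subset_of_nonneg (Finset.erase_subset _ _)
    fun z _ _ => proposal_nonneg _ _ _).trans ?_
  fin_cases g <;> fin_cases x <;> norm_num [Fin.sum_univ_four, proposal]

theorem moveProb_nonneg {ε : ℝ} (h : Admissible ε) (g : Param) (x y : State) :
    0 ≤ moveProb ε g x y :=
  mul_nonneg (proposal_nonneg _ _ _)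
    (le_min zero_le_one (div_nonneg (weight_pos h y).le (weight_pos h x).le))

theorem transProb_nonneg {ε : ℝ} (h : Admissible ε) (g : Param) (x y : State) :
    0 ≤ transProb ε g x y := by
  unfold transProb
  split_ifs
  · refine sub_nonneg.2 ((Finset.sum_le_sum fun z _ => ?_).trans (sum_proposal_le g x))
    exact mul_le_of_le_one_right (proposal_nonneg _ _ _) (min_le_left _ _)
  · exact moveProb_nonneg h g x y

theorem sum_transProb (ε : ℝ) (g : Param) (x : State) : ∑ y, transProb ε g x y = 1 := by
  rw [← Finset.add_sum_erase _ _ (Finset.mem_univ x)]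
  have : ∑ y ∈ Finset.univ.erase x, transProb ε g x y
      = ∑ y ∈ Finset.univ.erase x, moveProb ε g x y :=
    Finset.sum_congr rfl fun y hy => by simp [transProb, Finset.ne_of_mem_erase hy]
  rw [this]
  simp [transProb]

/-- The target distribution. -/
noncomputable def targetPMF (ε : ℝ) (h : Admissible ε) : PMF State :=
  PMF.ofFintype (fun x => ENNReal.ofReal (weight ε x)) (by
    rw [← ENNReal.ofReal_sum_of_nonneg fun x _ => (weight_pos h x).le, sum_weight,
      ENNReal.ofReal_one])

noncomputable def target (ε : ℝ) (h : Admissible ε) : Measure State := (targetPMF ε h).toMeasure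

/-- One step of the Metropolis algorithm with parameter `g` from the point `x`. -/
noncomputable def metropolisPMF (ε : ℝ) (h : Admissible ε) (g : Param) (x : State) : PMF State :=
  PMF.ofFintype (fun y => ENNReal.ofReal (transProb ε g x y)) (by
    rw [← ENNReal.ofReal_sum_of_nonneg fun y _ => transProb_nonneg h g x y, sum_transProb,
      ENNReal.ofReal_one])

noncomputable def metropolis (ε : ℝ) (h : Admissible ε) (g : Param) : Kernel State State :=
  Kernel.ofFunOfCountable fun x => (metropolisPMF ε h g x).toMeasure

/-! ### The adaptive algorithm -/

/-- The adaptation rule: `g` is the current parameter, the chain has just moved from `x` to `y`.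
From parameter `1`: switch to `2` if the chain moved, else keep `1`. From parameter `2`: switch
to `1` if the chain is now at the point `1`, else keep `2`. -/
def adapt (g : Param) (x y : State) : Param :=
  if g = 0 then (if y ≠ x then 1 else 0) else (if y = 0 then 0 else 1)

open Classical in
/-- One step of the algorithm. A pair `(x, g)` at time `n` consists of the position `X n` and of the
parameter that is used to draw `X (n + 1)`. The pairs at times `0, 1, 2` are the point `1` with
parameter `1`. For `n ≥ 2`, `X (n + 1)` is drawn from the kernel of parameter `g`, and right after
this draw the parameter is updated if `n = 2 ^ (k ^ 2)` for some `k ≥ 1`, and is kept otherwise. -/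
noncomputable def stepPMF (ε : ℝ) (h : Admissible ε) (n : ℕ) (s : State × Param) :
    PMF (State × Param) :=
  if n < 2 then PMF.pure (0, 0)
  else (metropolisPMF ε h s.2 s.1).map fun y =>
    (y, if ∃ k : ℕ, 1 ≤ k ∧ n = 2 ^ (k ^ 2) then adapt s.2 s.1 y else s.2)

/-- The step at time `n` as a kernel from histories up to time `n`. -/
noncomputable def stepKernel (ε : ℝ) (h : Admissible ε) (n : ℕ) :
    Kernel (Finset.Iic n → State × Param) (State × Param) :=
  Kernel.ofFunOfCountable fun p => (stepPMF ε h n (p ⟨n, Finset.mem_Iic.2 le_rfl⟩)).toMeasure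

instance (ε : ℝ) (h : Admissible ε) (n : ℕ) : IsMarkovKernel (stepKernel ε h n) :=
  ⟨fun p => by
    change IsProbabilityMeasure
      (stepPMF ε h n (p ⟨n, Finset.mem_Iic.2 le_rfl⟩)).toMeasure
    infer_instance⟩

/-- The law of the trajectory `(X n, parameter in force at time n)`, `n = 0, 1, 2, …`, started at
the point `1` with parameter `1`. -/
noncomputable def chainLaw (ε : ℝ) (h : Admissible ε) : Measure (ℕ → State × Param) :=
  Kernel.trajMeasure (X := fun _ => State × Param) (Measure.dirac (0, 0)) (stepKernel ε h)

/-- The chain `X n`. -/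
def chain (n : ℕ) (ω : ℕ → State × Param) : State := (ω n).1

end AirMCMC

/-!
Both kernels have transition matrices with the stationary vector `weight ε`, and their third powers
are entrywise positive, so the powers of each converge to the matrix with all rows equal to
`weight ε`. Two consequences of this mixing carry the theorem.

* Law of large numbers. Let `u g` solve the Poisson equation of the kernel `g`. While the parameter
  `g` is kept, `f (X n)` minus its stationary mean equals `u g (X n) - u g (X (n + 1))` plus a
  martingale increment. The first part telescopes, the averages of orthogonal bounded increments
  vanish almost surely, and the update times have density zero.
* Non-convergence. Between two update times the parameter is frozen for ever longer periods, so just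
  before an update the chain is nearly stationary, whatever the parameter. The update keeps or
  selects the first kernel mostly when the chain is at the point `1`, which this kernel leaves far
  less often than the second one. Hence two steps after an update the point `1` has probability
  exceeding `ε` by a fixed amount, while at the update its probability is about `ε`.
-/

namespace AirMCMC

open Matrix

section StochasticMatrices

lemma exists_pos_le_one_forall_le {ι : Type*} [Finite ι] (f : ι → ℝ) :
    ∃ p ∈ Set.Ioc (0 : ℝ) 1, ∀ i, 0 < f i → p ≤ f i := by
  have hev : ∀ᶠ p in 𝓝[>] (0 : ℝ), ∀ i, 0 < f i → p ≤ f i := by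
    refine eventually_all.2 fun i => ?_
    by_cases hi : 0 < f i
    · filter_upwards [Ioc_mem_nhdsGT hi] with p hp _ using hp.2
    · exact Eventually.of_forall fun p h => absurd h hi
  exact (Filter.Eventually.and (Ioc_mem_nhdsGT one_pos) hev).exists

lemma mul_apply_pos {ι : Type*} [Fintype ι] {A B : Matrix ι ι ℝ} (hA : ∀ i j, 0 ≤ A i j)
    (hB : ∀ i j, 0 ≤ B i j) {i j k : ι} (hij : 0 < A i j) (hjk : 0 < B j k) :
    0 < (A * B) i k :=
  Finset.sum_pos' (fun l _ => mul_nonneg (hA i l) (hB l k))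
    ⟨j, Finset.mem_univ j, mul_pos hij hjk⟩

lemma dotProduct_const_of_mem_stdSimplex {S : Type*} [Fintype S] {w : S → ℝ}
    (hw : w ∈ stdSimplex ℝ S) (c : ℝ) :
    (w ⬝ᵥ fun _ => c) = c := by
  simp only [dotProduct, ← Finset.sum_mul, hw.2, one_mul]

variable {S : Type*} [Fintype S] [DecidableEq S] {P : Matrix S S ℝ} {w : S → ℝ} {δ : ℝ}

lemma mulVec_const_of_mem_rowStochastic (hP : P ∈ rowStochastic ℝ S) (c : ℝ) :
    P *ᵥ (fun _ => c) = fun _ => c := by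
  ext x
  simp only [mulVec, dotProduct, ← Finset.sum_mul, sum_row_of_mem_rowStochastic hP, one_mul]

lemma vecMul_pow_eq_self (hwP : w ᵥ* P = w) (n : ℕ) : w ᵥ* P ^ n = w := by
  induction n with
  | zero => simp
  | succ n ih => rw [pow_succ, ← vecMul_vecMul, ih, hwP]

lemma vecMul_eq_self_of_detailedBalance (hP : P ∈ rowStochastic ℝ S)
    (h : ∀ x y, w x * P x y = w y * P y x) : w ᵥ* P = w := by
  ext y
  calc ∑ x, w x * P x y = ∑ x, w y * P y x := Finset.sum_congr rfl fun x _ => h x y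
    _ = w y := by rw [← Finset.mul_sum, sum_row_of_mem_rowStochastic hP, mul_one]

lemma norm_mulVec_le_of_mem_rowStochastic (hP : P ∈ rowStochastic ℝ S) (u : S → ℝ) :
    ‖P *ᵥ u‖ ≤ ‖u‖ := by
  refine (pi_norm_le_iff_of_nonneg (norm_nonneg u)).2 fun x => ?_
  calc ‖∑ y, P x y * u y‖ ≤ ∑ y, P x y * ‖u‖ := norm_sum_le_of_le _ fun y _ => by
        rw [norm_mul, Real.norm_of_nonneg (nonneg_of_mem_rowStochastic hP)]
        exact mul_le_mul_of_nonneg_left (norm_le_pi_norm u y) (nonneg_of_mem_rowStochastic hP)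
    _ = ‖u‖ := by rw [← Finset.sum_mul, sum_row_of_mem_rowStochastic hP, one_mul]

lemma minorisation_const_le_one (hP : P ∈ rowStochastic ℝ S) (hw : w ∈ stdSimplex ℝ S)
    (hδ : ∀ x y, δ * w y ≤ P x y) : δ ≤ 1 := by
  rcases isEmpty_or_nonempty S with hS | ⟨⟨x⟩⟩
  · exact absurd hw.2 (by simp)
  calc δ = ∑ y, δ * w y := by rw [← Finset.mul_sum, hw.2, mul_one]
    _ ≤ ∑ y, P x y := Finset.sum_le_sum fun y _ => hδ x y
    _ = 1 := sum_row_of_mem_rowStochastic hP x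

/-- Doeblin's argument: a centred function does not see the part `δ • w` common to all rows. -/
lemma norm_mulVec_le_of_minorised (hP : P ∈ rowStochastic ℝ S) (hw : w ∈ stdSimplex ℝ S)
    (hδ : ∀ x y, δ * w y ≤ P x y) {u : S → ℝ} (hu : w ⬝ᵥ u = 0) :
    ‖P *ᵥ u‖ ≤ (1 - δ) * ‖u‖ := by
  have hδ1 := minorisation_const_le_one hP hw hδ
  refine (pi_norm_le_iff_of_nonneg (mul_nonneg (by linarith) (norm_nonneg u))).2 fun x => ?_
  calc ‖∑ y, P x y * u y‖ = ‖∑ y, (P x y - δ * w y) * u y‖ := by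
        have hwu : ∑ y, w y * u y = 0 := hu
        simp only [sub_mul, Finset.sum_sub_distrib, mul_assoc, ← Finset.mul_sum, hwu, mul_zero,
          sub_zero]
    _ ≤ ∑ y, (P x y - δ * w y) * ‖u‖ := norm_sum_le_of_le _ fun y _ => by
        rw [norm_mul, Real.norm_of_nonneg (sub_nonneg.2 (hδ x y))]
        exact mul_le_mul_of_nonneg_left (norm_le_pi_norm u y) (sub_nonneg.2 (hδ x y))
    _ = (1 - δ) * ‖u‖ := by
        rw [← Finset.sum_mul, Finset.sum_sub_distrib, ← Finset.mul_sum, hw.2,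
          sum_row_of_mem_rowStochastic hP, mul_one]

lemma norm_pow_mulVec_le_of_minorised (hP : P ∈ rowStochastic ℝ S) (hw : w ∈ stdSimplex ℝ S)
    (hδ : ∀ x y, δ * w y ≤ P x y) (hwP : w ᵥ* P = w) {u : S → ℝ} (hu : w ⬝ᵥ u = 0) (n : ℕ) :
    ‖P ^ n *ᵥ u‖ ≤ (1 - δ) ^ n * ‖u‖ := by
  have hδ1 := minorisation_const_le_one hP hw hδ
  induction n with
  | zero => simp
  | succ n ih =>
    have hcentred : w ⬝ᵥ P ^ n *ᵥ u = 0 := by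
      rw [dotProduct_mulVec, vecMul_pow_eq_self hwP, hu]
    calc ‖P ^ (n + 1) *ᵥ u‖ = ‖P *ᵥ (P ^ n *ᵥ u)‖ := by rw [pow_succ', mulVec_mulVec]
      _ ≤ (1 - δ) * ‖P ^ n *ᵥ u‖ := norm_mulVec_le_of_minorised hP hw hδ hcentred
      _ ≤ (1 - δ) * ((1 - δ) ^ n * ‖u‖) := mul_le_mul_of_nonneg_left ih (by linarith)
      _ = (1 - δ) ^ (n + 1) * ‖u‖ := by ring

lemma exists_minorised_pow_of_isPrimitive (hprim : P.IsPrimitive) (hw : w ∈ stdSimplex ℝ S) :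
    ∃ k > 0, ∃ δ > 0, ∀ x y, δ * w y ≤ (P ^ k) x y := by
  obtain ⟨k, hk, hpos⟩ := hprim.exists_pos_pow
  obtain ⟨δ, ⟨hδ, -⟩, hle⟩ := exists_pos_le_one_forall_le fun z : S × S => (P ^ k) z.1 z.2
  refine ⟨k, hk, δ, hδ, fun x y => ?_⟩
  have hwy : w y ≤ 1 := hw.2 ▸ Finset.single_le_sum (fun z _ => hw.1 z) (Finset.mem_univ y)
  exact (mul_le_of_le_one_right hδ.le hwy).trans (hle (x, y) (hpos x y))

lemma tendsto_pow_mulVec_zero (hP : P ∈ rowStochastic ℝ S) (hprim : P.IsPrimitive)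
    (hw : w ∈ stdSimplex ℝ S) (hwP : w ᵥ* P = w) {u : S → ℝ} (hu : w ⬝ᵥ u = 0) :
    Tendsto (fun n => P ^ n *ᵥ u) atTop (𝓝 0) := by
  obtain ⟨k, hk, δ, hδ, hle⟩ := exists_minorised_pow_of_isPrimitive hprim hw
  have hδ1 := minorisation_const_le_one (pow_mem hP k) hw hle
  have hbound (n : ℕ) : ‖P ^ n *ᵥ u‖ ≤ (1 - δ) ^ (n / k) * ‖u‖ := by
    calc ‖P ^ n *ᵥ u‖ = ‖P ^ (n % k) *ᵥ ((P ^ k) ^ (n / k) *ᵥ u)‖ := by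
          rw [mulVec_mulVec, ← pow_mul, ← pow_add, Nat.mod_add_div]
      _ ≤ ‖(P ^ k) ^ (n / k) *ᵥ u‖ := norm_mulVec_le_of_mem_rowStochastic (pow_mem hP _) _
      _ ≤ (1 - δ) ^ (n / k) * ‖u‖ :=
        norm_pow_mulVec_le_of_minorised (pow_mem hP k) hw hle (vecMul_pow_eq_self hwP k) hu _
  have hlim : Tendsto (fun n : ℕ => (1 - δ) ^ (n / k) * ‖u‖) atTop (𝓝 0) := by
    simpa using ((tendsto_pow_atTop_nhds_zero_of_lt_one (by linarith) (by linarith)).comp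
      (Nat.tendsto_div_const_atTop hk.ne')).mul_const ‖u‖
  exact squeeze_zero_norm hbound hlim

theorem tendsto_pow_mulVec (hP : P ∈ rowStochastic ℝ S) (hprim : P.IsPrimitive)
    (hw : w ∈ stdSimplex ℝ S) (hwP : w ᵥ* P = w) (u : S → ℝ) :
    Tendsto (fun n => P ^ n *ᵥ u) atTop (𝓝 fun _ => w ⬝ᵥ u) := by
  have hu : (w ⬝ᵥ (u - fun _ => w ⬝ᵥ u)) = 0 := by
    rw [dotProduct_sub, dotProduct_const_of_mem_stdSimplex hw, sub_self]
  refine tendsto_sub_nhds_zero_iff.1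
    ((tendsto_pow_mulVec_zero hP hprim hw hwP hu).congr fun n => ?_)
  rw [mulVec_sub, mulVec_const_of_mem_rowStochastic (pow_mem hP n)]

/-- The operator `u ↦ u - P u + w(u)` is injective, because a kernel element is centred and fixed by
all powers of `P`; in finite dimension it is therefore onto. -/
theorem exists_poisson_solution (hP : P ∈ rowStochastic ℝ S) (hprim : P.IsPrimitive)
    (hw : w ∈ stdSimplex ℝ S) (hwP : w ᵥ* P = w) (f : S → ℝ) :
    ∃ u : S → ℝ, ∀ x, f x - w ⬝ᵥ f = u x - (P *ᵥ u) x := by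
  let T : (S → ℝ) →ₗ[ℝ] S → ℝ := (1 - P + of fun _ => w).mulVecLin
  have T_apply (u : S → ℝ) : T u = u - P *ᵥ u + fun _ => w ⬝ᵥ u := by
    simp only [T, mulVecLin_apply, add_mulVec, sub_mulVec, one_mulVec]
    rfl
  have dotProduct_T (u : S → ℝ) : w ⬝ᵥ T u = w ⬝ᵥ u := by
    rw [T_apply, dotProduct_add, dotProduct_sub, dotProduct_mulVec, hwP, sub_self, zero_add,
      dotProduct_const_of_mem_stdSimplex hw]
  have T_injective : Function.Injective T := by
    refine LinearMap.ker_eq_bot.1 (LinearMap.ker_eq_bot'.2 fun u hu => ?_)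
    have hcentred : w ⬝ᵥ u = 0 := by rw [← dotProduct_T, hu, dotProduct_zero]
    have hfixed : P *ᵥ u = u := by
      ext x
      simpa [T_apply, hcentred, sub_eq_zero, eq_comm] using congr_fun hu x
    have hpow (n : ℕ) : P ^ n *ᵥ u = u := by
      induction n with
      | zero => simp
      | succ n ih => rw [pow_succ, ← mulVec_mulVec, hfixed, ih]
    refine tendsto_nhds_unique tendsto_const_nhds
      ((tendsto_pow_mulVec_zero hP hprim hw hwP hcentred).congr hpow)
  obtain ⟨u, hu⟩ := LinearMap.injective_iff_surjective.1 T_injective (f - fun _ => w ⬝ᵥ f)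
  have hcentred : w ⬝ᵥ u = 0 := by
    rw [← dotProduct_T, hu, dotProduct_sub, dotProduct_const_of_mem_stdSimplex hw, sub_self]
  refine ⟨u, fun x => ?_⟩
  simpa [T_apply, hcentred] using (congr_fun hu x).symm

/-- With `θ` small, `θ ^ r` gains more from a possible decrease of the rank `r` than it can lose, so
`2 - θ ^ r` is a drift function. -/
theorem exists_geometric_drift_of_rank {G : Type*} [Finite G] {P : G → Matrix S S ℝ}
    (hP : ∀ g, P g ∈ rowStochastic ℝ S) {C : Set S} (r : S → ℕ)
    (hr : ∀ g, ∀ x ∉ C, ∃ y, r y < r x ∧ 0 < P g x y) :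
    ∃ (V : S → ℝ) (lam b : ℝ), (∀ x, 1 ≤ V x) ∧ 0 < lam ∧ lam < 1 ∧
      ∀ g x, (P g *ᵥ V) x ≤ lam * V x + b * C.indicator (fun _ => 1) x := by
  obtain ⟨p, hp, hpP⟩ := exists_pos_le_one_forall_le fun z : G × S × S => P z.1 z.2.1 z.2.2
  set θ := p / 2 with hθ
  have hθ0 : 0 < θ := half_pos hp.1
  have hθ1 : θ ≤ 1 := by linarith [hp.2]
  obtain ⟨c, hc, hcθ⟩ := exists_pos_le_one_forall_le fun x : S => θ ^ r x
  let V : S → ℝ := fun x => 2 - θ ^ r x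
  have hV (x : S) : 1 ≤ V x ∧ V x ≤ 2 := by
    have h₀ : 0 < θ ^ r x := pow_pos hθ0 _
    have h₁ : θ ^ r x ≤ 1 := pow_le_one₀ hθ0.le hθ1
    constructor <;> linarith
  have hPV (g : G) (x : S) : (P g *ᵥ V) x = 2 - (P g *ᵥ fun y => θ ^ r y) x := by
    change (P g *ᵥ ((fun _ => 2) - fun y => θ ^ r y)) x = _
    rw [mulVec_sub, mulVec_const_of_mem_rowStochastic (hP g), Pi.sub_apply]
  have hterm (g : G) (x y : S) : 0 ≤ P g x y * θ ^ r y :=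
    mul_nonneg (nonneg_of_mem_rowStochastic (hP g)) (pow_pos hθ0 _).le
  refine ⟨V, 1 - c / 2, 2, fun x => (hV x).1, by linarith [hc.2], by linarith [hc.1],
    fun g x => ?_⟩
  rw [hPV]
  by_cases hx : x ∈ C
  · have hsum : 0 ≤ (P g *ᵥ fun y => θ ^ r y) x := Finset.sum_nonneg fun y _ => hterm g x y
    rw [Set.indicator_of_mem hx]
    nlinarith [hV x, hc.1, hc.2]
  · obtain ⟨y, hyx, hpos⟩ := hr g x hx
    have hpow : θ ^ r x ≤ θ ^ (r y + 1) := pow_le_pow_of_le_one hθ0.le hθ1 hyx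
    have hgain : 2 * θ ^ r x ≤ (P g *ᵥ fun y => θ ^ r y) x := by
      calc 2 * θ ^ r x ≤ 2 * θ ^ (r y + 1) := by gcongr
        _ = p * θ ^ r y := by rw [pow_succ, hθ]; ring
        _ ≤ P g x y * θ ^ r y := by gcongr; exact hpP (g, x, y) hpos
        _ ≤ _ := Finset.single_le_sum (fun z _ => hterm g x z) (Finset.mem_univ y)
    rw [Set.indicator_of_notMem hx]
    have hVx : V x = 2 - θ ^ r x := rfl
    nlinarith [hV x, hVx, hcθ x (pow_pos hθ0 _), hc.1]

end StochasticMatrices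

section FiniteKernels

variable {S : Type*} [MeasurableSpace S]

/-- The mass function of a measure, as a row vector; it determines the measure on a finite
space. -/
noncomputable def massFunction (φ : Measure S) : S → ℝ := fun x => φ.real {x}

/-- The matrix of the one-point transition probabilities of a kernel. -/
noncomputable def transitionMatrix (κ : Kernel S S) : Matrix S S ℝ :=
  of fun x => massFunction (κ x)

lemma transitionMatrix_apply (κ : Kernel S S) (x y : S) :
    transitionMatrix κ x y = (κ x).real {y} := rfl

lemma isAperiodic_of_transitionMatrix_self_pos {φ : Measure S} {κ : Kernel S S}
    [IsMarkovKernel κ] {x : S} (hφ : φ {x} ≠ 0) (hx : 0 < transitionMatrix κ x x) :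
    IsAperiodic φ κ := by
  rintro d hd ⟨D, hD, hdisj, hcycle, hcover⟩
  have : Fact (1 < d) := ⟨hd⟩
  have hxD : x ∈ ⋃ i, D i := by
    by_contra hx'
    exact hφ (measure_mono_null (Set.singleton_subset_iff.2 hx') hcover)
  obtain ⟨i, hi⟩ := Set.mem_iUnion.1 hxD
  have hnot : {x} ⊆ (D (i + 1))ᶜ := Set.singleton_subset_iff.2
    (Set.disjoint_left.1 (hdisj (show i ≠ i + 1 by simp)) hi)
  have hnull := measure_mono_null hnot ((prob_compl_eq_zero_iff (hD (i + 1))).2 (hcycle i x hi))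
  simp [transitionMatrix_apply, measureReal_def, hnull] at hx

variable [MeasurableSingletonClass S]

lemma simultaneousMinorisation_singleton {G : Type*} [Finite G] {φ : Measure S}
    {κ : G → Kernel S S} {x : S} (hφ : φ {x} ≠ 0)
    (hx : ∀ g, 0 < transitionMatrix (κ g) x x) : SimultaneousMinorisation φ κ {x} := by
  obtain ⟨δ, ⟨hδ, -⟩, hle⟩ := exists_pos_le_one_forall_le fun g => transitionMatrix (κ g) x x
  refine ⟨measurableSet_singleton x, pos_iff_ne_zero.2 hφ, Measure.dirac x, δ, inferInstance, hδ,
    fun g y hy => ?_⟩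
  rw [Set.mem_singleton_iff.1 hy]
  calc ENNReal.ofReal δ • Measure.dirac x ≤ κ g x {x} • Measure.dirac x := by
        gcongr
        exact ENNReal.ofReal_le_of_le_toReal (hle g (hx g))
    _ = (κ g x).restrict {x} := (Measure.restrict_singleton _ x).symm
    _ ≤ κ g x := Measure.restrict_le_self

lemma transitionMatrix_id [DecidableEq S] : transitionMatrix (Kernel.id : Kernel S S) = 1 := by
  ext x y
  simp [transitionMatrix_apply, measureReal_def, Kernel.id_apply, one_apply, Set.indicator_apply,
    apply_ite]

section Fintype

variable [Fintype S]

lemma integral_eq_massFunction_dotProduct (φ : Measure S) [IsFiniteMeasure φ] (f : S → ℝ) :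
    ∫ x, f x ∂φ = massFunction φ ⬝ᵥ f :=
  integral_fintype Integrable.of_finite

lemma massFunction_mem_stdSimplex (φ : Measure S) [IsProbabilityMeasure φ] :
    massFunction φ ∈ stdSimplex ℝ S := by
  refine ⟨fun x => measureReal_nonneg, ?_⟩
  simpa [dotProduct] using (integral_eq_massFunction_dotProduct φ fun _ => 1).symm

lemma massFunction_bind (φ : Measure S) [IsFiniteMeasure φ] (κ : Kernel S S) [IsMarkovKernel κ] :
    massFunction (φ.bind κ) = massFunction φ ᵥ* transitionMatrix κ := by
  ext y
  calc (φ.bind κ).real {y} = ∫ x, (κ x {y}).toReal ∂φ := by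
        rw [integral_toReal (κ.measurable_coe (measurableSet_singleton y)).aemeasurable
          (Eventually.of_forall fun x => measure_lt_top _ _), measureReal_def,
          Measure.bind_apply (measurableSet_singleton y) κ.aemeasurable]
    _ = (massFunction φ ᵥ* transitionMatrix κ) y := integral_eq_massFunction_dotProduct φ _

lemma invariant_of_massFunction_vecMul {φ : Measure S} [IsFiniteMeasure φ] {κ : Kernel S S}
    [IsMarkovKernel κ] (h : massFunction φ ᵥ* transitionMatrix κ = massFunction φ) :
    κ.Invariant φ :=
  Measure.ext_of_singleton fun x => (measureReal_eq_measureReal_iff).1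
    (congr_fun ((massFunction_bind φ κ).trans h) x)

lemma transitionMatrix_comp (κ η : Kernel S S) [IsMarkovKernel κ] [IsMarkovKernel η] :
    transitionMatrix (κ ∘ₖ η) = transitionMatrix η * transitionMatrix κ :=
  Matrix.ext fun x y => congr_fun (massFunction_bind (η x) κ) y

variable [DecidableEq S]

lemma transitionMatrix_mem_rowStochastic (κ : Kernel S S) [IsMarkovKernel κ] :
    transitionMatrix κ ∈ rowStochastic ℝ S :=
  mem_rowStochastic_iff_sum.2 ⟨fun _ _ => measureReal_nonneg,
    fun x => (massFunction_mem_stdSimplex (κ x)).2⟩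

lemma transitionMatrix_pow (κ : Kernel S S) [IsMarkovKernel κ] (n : ℕ) :
    transitionMatrix (κ ^ n) = transitionMatrix κ ^ n := by
  suffices h : IsMarkovKernel (κ ^ n) ∧ transitionMatrix (κ ^ n) = transitionMatrix κ ^ n from h.2
  induction n with
  | zero => exact ⟨inferInstanceAs (IsMarkovKernel Kernel.id), transitionMatrix_id⟩
  | succ n ih =>
    have : IsMarkovKernel (κ ^ n) := ih.1
    rw [pow_succ', pow_succ, ← ih.2]
    exact ⟨inferInstanceAs (IsMarkovKernel (κ ∘ₖ (κ ^ n))), transitionMatrix_comp κ (κ ^ n)⟩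

end Fintype

variable [Finite S]

lemma isIrreducible_of_transitionMatrix {κ : Kernel S S} [IsMarkovKernel κ]
    (h : (transitionMatrix κ).IsIrreducible) (φ : Measure S) : κ.IsIrreducible φ := by
  classical
  have := Fintype.ofFinite S
  refine ⟨fun A _ hA x => ?_⟩
  obtain ⟨y, hy⟩ := nonempty_of_measure_ne_zero hA.ne'
  obtain ⟨n, -, hn⟩ := (isIrreducible_iff_exists_pow_pos h.nonneg).1 h x y
  rw [← transitionMatrix_pow] at hn
  exact ⟨n, (ENNReal.toReal_pos_iff.1 hn).1.trans_le
    (measure_mono (Set.singleton_subset_iff.2 hy))⟩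

theorem simultaneousGeometricDrift_of_rank {G : Type*} [Finite G] {κ : G → Kernel S S}
    [∀ g, IsMarkovKernel (κ g)] {C : Set S} (r : S → ℕ)
    (hr : ∀ g, ∀ x ∉ C, ∃ y, r y < r x ∧ 0 < transitionMatrix (κ g) x y) :
    SimultaneousGeometricDrift κ C := by
  classical
  have := Fintype.ofFinite S
  obtain ⟨V, lam, b, hV, hlam₀, hlam₁, hdrift⟩ := exists_geometric_drift_of_rank
    (fun g => transitionMatrix_mem_rowStochastic (κ g)) r hr
  refine ⟨V, lam, b, measurable_of_finite V, hV, hlam₀, hlam₁, fun g x => ?_⟩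
  rw [← ofReal_integral_eq_lintegral_ofReal Integrable.of_finite
    (Eventually.of_forall fun y => zero_le_one.trans (hV y)),
    integral_eq_massFunction_dotProduct]
  exact ENNReal.ofReal_le_ofReal (hdrift g x)

end FiniteKernels

section Averages

/-- The average of the first `N` terms of a sequence; it is `0` for `N = 0`. -/
noncomputable def cesaroMean (a : ℕ → ℝ) (N : ℕ) : ℝ := (1 / (N : ℝ)) * ∑ i ∈ Finset.range N, a i

/-- Asymptotic density zero for a set of natural numbers. -/
def HasDensityZero (J : Set ℕ) : Prop :=
  Tendsto (cesaroMean (J.indicator fun _ => 1)) atTop (𝓝 0)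

variable {a b : ℕ → ℝ} {C : ℝ}

lemma cesaroMean_add (a b : ℕ → ℝ) (N : ℕ) :
    cesaroMean (fun i => a i + b i) N = cesaroMean a N + cesaroMean b N := by
  simp only [cesaroMean, Finset.sum_add_distrib, mul_add]

lemma cesaroMean_add_const (a : ℕ → ℝ) (c : ℝ) {N : ℕ} (hN : N ≠ 0) :
    cesaroMean (fun i => a i + c) N = cesaroMean a N + c := by
  rw [cesaroMean_add]
  simp [cesaroMean, hN]

lemma abs_cesaroMean_le (h : ∀ i, |a i| ≤ b i) (N : ℕ) : |cesaroMean a N| ≤ cesaroMean b N := by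
  rw [cesaroMean, abs_mul, abs_of_nonneg (by positivity)]
  exact mul_le_mul_of_nonneg_left
    ((Finset.abs_sum_le_sum_abs _ _).trans (Finset.sum_le_sum fun i _ => h i)) (by positivity)

lemma HasDensityZero.tendsto_cesaroMean {J : Set ℕ} (hJ : HasDensityZero J)
    (ha : ∀ i, |a i| ≤ C) (haJ : ∀ i ∉ J, a i = 0) : Tendsto (cesaroMean a) atTop (𝓝 0) := by
  have hle (i : ℕ) : |a i| ≤ C * J.indicator (fun _ => 1) i := by
    by_cases hi : i ∈ J
    · simpa [hi] using ha i
    · simp [hi, haJ i hi]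
  have hlim := hJ.const_mul C
  rw [mul_zero] at hlim
  refine squeeze_zero_norm (fun N => (abs_cesaroMean_le hle N).trans_eq ?_) hlim
  simp only [cesaroMean, ← Finset.mul_sum]
  ring

lemma tendsto_cesaroMean_sub_succ (ha : ∀ i, |a i| ≤ C) :
    Tendsto (cesaroMean fun i => a i - a (i + 1)) atTop (𝓝 0) := by
  refine squeeze_zero_norm (fun N => ?_) (tendsto_const_div_atTop_nhds_zero_nat (2 * C))
  rw [cesaroMean, Finset.sum_range_sub', norm_mul, Real.norm_of_nonneg (by positivity),
    one_div_mul_eq_div]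
  gcongr
  exact (abs_sub _ _).trans (by linarith [ha 0, ha N])

lemma HasDensityZero.tendsto_cesaroMean_of_eq_sub_succ_add {J : Set ℕ} (hJ : HasDensityZero J)
    {e : ℕ → ℝ} {A B E : ℝ} (ha : ∀ i, |a i| ≤ A) (hb : ∀ i, |b i| ≤ B) (he : ∀ i, |e i| ≤ E)
    (heq : ∀ i ∉ J, a i = b i - b (i + 1) + e i) (hlim : Tendsto (cesaroMean e) atTop (𝓝 0)) :
    Tendsto (cesaroMean a) atTop (𝓝 0) := by
  have hres : Tendsto (cesaroMean fun i => a i - (b i - b (i + 1) + e i)) atTop (𝓝 0) := by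
    refine hJ.tendsto_cesaroMean (C := A + (B + B + E)) (fun i => ?_)
      fun i hi => sub_eq_zero.2 (heq i hi)
    refine (abs_sub _ _).trans (add_le_add (ha i) ((abs_add_le _ _).trans (add_le_add ?_ (he i))))
    exact (abs_sub _ _).trans (add_le_add (hb i) (hb (i + 1)))
  have hsum := hres.add ((tendsto_cesaroMean_sub_succ hb).add hlim)
  simp only [← cesaroMean_add, sub_add_cancel, add_zero] at hsum
  exact hsum

/-- Adding a constant makes the partial sums monotone, and for monotone partial sums the squares are
dense enough. -/
lemma tendsto_cesaroMean_of_tendsto_sq (ha : ∀ i, |a i| ≤ C) {l : ℝ}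
    (h : Tendsto (fun m : ℕ => cesaroMean a (m ^ 2)) atTop (𝓝 l)) :
    Tendsto (cesaroMean a) atTop (𝓝 l) := by
  suffices hshift : Tendsto (cesaroMean fun i => a i + C) atTop (𝓝 (l + C)) by
    have hlim := hshift.sub_const C
    rw [add_sub_cancel_right] at hlim
    refine hlim.congr' ((eventually_ne_atTop 0).mono fun N hN => ?_)
    rw [cesaroMean_add_const a C hN, add_sub_cancel_right]
  have hmono : Monotone fun N => ∑ i ∈ Finset.range N, (a i + C) :=
    monotone_nat_of_le_succ fun N => by
      rw [Finset.sum_range_succ]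
      linarith [neg_le_of_abs_le (ha N)]
  have hdiv := tendsto_div_of_monotone_of_exists_subseq_tendsto_div _ (l + C) hmono
    fun r hr => ⟨fun m => m ^ 2, ?_, tendsto_pow_atTop two_ne_zero, ?_⟩
  · exact hdiv.congr fun N => (one_div_mul_eq_div _ _).symm
  · have hratio : Tendsto (fun m : ℕ => (1 + 1 / (m : ℝ)) ^ 2) atTop (𝓝 1) := by
      simpa using ((tendsto_one_div_atTop_nhds_zero_nat (𝕜 := ℝ)).const_add 1).pow 2
    filter_upwards [hratio.eventually_le_const hr, eventually_ne_atTop 0] with m hm hm0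
    calc (((m + 1) ^ 2 : ℕ) : ℝ) = (1 + 1 / (m : ℝ)) ^ 2 * (m ^ 2 : ℕ) := by
          push_cast
          field_simp
      _ ≤ r * (m ^ 2 : ℕ) := by gcongr
  · refine (h.add_const C).congr' ((eventually_ne_atTop 0).mono fun m hm => ?_)
    rw [← cesaroMean_add_const a C (pow_ne_zero 2 hm), cesaroMean, one_div_mul_eq_div]

lemma abs_indicator_one_le (J : Set ℕ) (i : ℕ) : |J.indicator (fun _ => (1 : ℝ)) i| ≤ 1 :=
  (norm_indicator_le_norm_self (fun _ => (1 : ℝ)) i).trans_eq norm_one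

lemma HasDensityZero.union {J K : Set ℕ} (hJ : HasDensityZero J) (hK : HasDensityZero K) :
    HasDensityZero (J ∪ K) := by
  have hle (i : ℕ) : |(J ∪ K).indicator (fun _ => (1 : ℝ)) i| ≤
      J.indicator (fun _ => 1) i + K.indicator (fun _ => 1) i := by
    by_cases hJi : i ∈ J <;> by_cases hKi : i ∈ K <;> simp [hJi, hKi]
  refine squeeze_zero_norm (fun N => abs_cesaroMean_le hle N) ?_
  have hlim := Tendsto.add hJ hK
  rw [add_zero] at hlim
  exact hlim.congr fun N => (cesaroMean_add _ _ N).symm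

lemma hasDensityZero_Iio (m : ℕ) : HasDensityZero (Set.Iio m) := by
  have hlim : Tendsto ((Set.Iio m).indicator fun _ => (1 : ℝ)) atTop (𝓝 0) :=
    tendsto_const_nhds.congr' ((eventually_ge_atTop m).mono fun n hn =>
      (Set.indicator_of_notMem (s := Set.Iio m) hn.not_gt fun _ => (1 : ℝ)).symm)
  exact hlim.cesaro.congr fun N => by rw [cesaroMean, one_div]

lemma hasDensityZero_range_of_sq_le {b : ℕ → ℕ} (hb : ∀ k, k ^ 2 ≤ b k) :
    HasDensityZero (Set.range b) := by
  classical
  refine tendsto_cesaroMean_of_tendsto_sq (abs_indicator_one_le _) ?_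
  refine squeeze_zero_norm (fun m => ?_) (tendsto_one_div_atTop_nhds_zero_nat (𝕜 := ℝ))
  have hsub : {n ∈ Finset.range (m ^ 2) | n ∈ Set.range b} ⊆ (Finset.range m).image b := by
    intro n hn
    obtain ⟨hnm, k, rfl⟩ := Finset.mem_filter.1 hn
    exact Finset.mem_image_of_mem b (Finset.mem_range.2
      (lt_of_pow_lt_pow_left₀ 2 m.zero_le ((hb k).trans_lt (Finset.mem_range.1 hnm))))
  have hcard : ({n ∈ Finset.range (m ^ 2) | n ∈ Set.range b}.card : ℝ) ≤ m := by
    exact_mod_cast (Finset.card_le_card hsub).trans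
      (Finset.card_image_le.trans_eq (Finset.card_range m))
  calc ‖cesaroMean ((Set.range b).indicator fun _ => 1) (m ^ 2)‖
      = 1 / ((m ^ 2 : ℕ) : ℝ) * {n ∈ Finset.range (m ^ 2) | n ∈ Set.range b}.card := by
        rw [cesaroMean, Finset.sum_indicator_eq_sum_filter]
        simp
    _ ≤ 1 / ((m ^ 2 : ℕ) : ℝ) * m := by gcongr
    _ = 1 / m := by
        rcases eq_or_ne m 0 with rfl | hm
        · simp
        · push_cast
          field_simp

variable {Ω : Type*} [MeasurableSpace Ω] {μ : Measure Ω}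

lemma integral_sq_sum_of_orthogonal {ι : Type*} {d : ι → Ω → ℝ} (hd : ∀ i, MemLp (d i) 2 μ)
    (horth : Pairwise fun i j => ∫ ω, d i ω * d j ω ∂μ = 0) (s : Finset ι) :
    ∫ ω, (∑ i ∈ s, d i ω) ^ 2 ∂μ = ∑ i ∈ s, ∫ ω, d i ω ^ 2 ∂μ := by
  have hint (i j : ι) : Integrable (fun ω => d i ω * d j ω) μ := (hd i).integrable_mul (hd j)
  simp only [sq, Finset.sum_mul_sum]
  rw [integral_finsetSum _ fun i _ => integrable_finsetSum _ fun j _ => hint i j]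
  refine Finset.sum_congr rfl fun i hi => ?_
  rw [integral_finsetSum _ fun j _ => hint i j]
  exact Finset.sum_eq_single_of_mem i hi fun j _ hji => horth hji.symm

lemma ae_tendsto_zero_of_summable_integral_sq {Y : ℕ → Ω → ℝ} (hY : ∀ m, MemLp (Y m) 2 μ)
    (hsum : Summable fun m => ∫ ω, Y m ω ^ 2 ∂μ) :
    ∀ᵐ ω ∂μ, Tendsto (fun m => Y m ω) atTop (𝓝 0) := by
  have hmeas (m : ℕ) : AEMeasurable (fun ω => ENNReal.ofReal (Y m ω ^ 2)) μ :=
    ((hY m).1.aemeasurable.pow_const 2).ennreal_ofReal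
  have hfin : ∫⁻ ω, ∑' m, ENNReal.ofReal (Y m ω ^ 2) ∂μ ≠ ⊤ := by
    rw [lintegral_tsum hmeas]
    convert hsum.tsum_ofReal_ne_top using 3 with m
    exact (ofReal_integral_eq_lintegral_ofReal (hY m).integrable_sq
      (Eventually.of_forall fun ω => sq_nonneg _)).symm
  filter_upwards [ae_lt_top' (AEMeasurable.tsum hmeas) hfin] with ω hω
  have hsq : Tendsto (fun m => Y m ω ^ 2) atTop (𝓝 0) := by
    simpa [Function.comp_def, ENNReal.toReal_ofReal (sq_nonneg _)] using
      (ENNReal.tendsto_toReal ENNReal.zero_ne_top).comp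
        (ENNReal.tendsto_atTop_zero_of_tsum_ne_top hω.ne)
  refine (tendsto_zero_iff_abs_tendsto_zero _).2 ?_
  simpa [Function.comp_def, Real.sqrt_sq_eq_abs] using hsq.sqrt

lemma integral_sq_cesaroMean_le_of_orthogonal [IsFiniteMeasure μ] {d : ℕ → Ω → ℝ}
    (hd : ∀ i, MemLp (d i) 2 μ) (hC : ∀ i ω, |d i ω| ≤ C)
    (horth : Pairwise fun i j => ∫ ω, d i ω * d j ω ∂μ = 0) (N : ℕ) :
    ∫ ω, cesaroMean (fun i => d i ω) N ^ 2 ∂μ ≤ C ^ 2 * μ.real Set.univ * (1 / (N : ℝ)) := by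
  have hsq (i : ℕ) : ∫ ω, d i ω ^ 2 ∂μ ≤ C ^ 2 * μ.real Set.univ := by
    calc ∫ ω, d i ω ^ 2 ∂μ ≤ ∫ _, C ^ 2 ∂μ := integral_mono (hd i).integrable_sq
          (integrable_const _) fun ω => sq_le_sq.2 ((hC i ω).trans (le_abs_self C))
      _ = C ^ 2 * μ.real Set.univ := by rw [integral_const, smul_eq_mul, mul_comm]
  simp only [cesaroMean, mul_pow]
  rw [integral_const_mul, integral_sq_sum_of_orthogonal hd horth]
  calc (1 / (N : ℝ)) ^ 2 * ∑ i ∈ Finset.range N, ∫ ω, d i ω ^ 2 ∂μ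
      ≤ (1 / (N : ℝ)) ^ 2 * ∑ i ∈ Finset.range N, C ^ 2 * μ.real Set.univ := by
        gcongr with i
        exact hsq i
    _ = C ^ 2 * μ.real Set.univ * (1 / (N : ℝ)) := by
        rw [Finset.sum_const, Finset.card_range, nsmul_eq_mul]
        field_simp

theorem ae_tendsto_cesaroMean_of_orthogonal [IsFiniteMeasure μ] {d : ℕ → Ω → ℝ}
    (hd : ∀ i, AEStronglyMeasurable (d i) μ) (hC : ∀ i ω, |d i ω| ≤ C)
    (horth : Pairwise fun i j => ∫ ω, d i ω * d j ω ∂μ = 0) :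
    ∀ᵐ ω ∂μ, Tendsto (cesaroMean fun i => d i ω) atTop (𝓝 0) := by
  have hLp (i : ℕ) : MemLp (d i) 2 μ :=
    MemLp.of_bound (hd i) C (Eventually.of_forall fun ω => hC i ω)
  have hsummable : Summable fun m : ℕ => ∫ ω, cesaroMean (fun i => d i ω) (m ^ 2) ^ 2 ∂μ := by
    refine Summable.of_nonneg_of_le (fun m => integral_nonneg fun ω => sq_nonneg _)
      (fun m => integral_sq_cesaroMean_le_of_orthogonal hLp hC horth (m ^ 2)) ?_
    simpa using (Real.summable_one_div_nat_pow.2 one_lt_two).mul_left (C ^ 2 * μ.real Set.univ)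
  have hmean (N : ℕ) : MemLp (fun ω => cesaroMean (fun i => d i ω) N) 2 μ :=
    (memLp_finsetSum _ fun i _ => hLp i).const_mul _
  filter_upwards [ae_tendsto_zero_of_summable_integral_sq (fun m => hmean (m ^ 2)) hsummable]
    with ω hω using tendsto_cesaroMean_of_tendsto_sq (fun i => hC i ω) hω

end Averages

section DrivenChains

variable {Ω : Type*} {mΩ : MeasurableSpace Ω} {μ : Measure Ω}

lemma integral_mul_eq_zero_of_condExp_eq_zero {m : MeasurableSpace Ω} (hm : m ≤ mΩ)
    [SigmaFinite (μ.trim hm)] {f g : Ω → ℝ} (hf : StronglyMeasurable[m] f)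
    (hfg : Integrable (fun ω => f ω * g ω) μ) (hg : Integrable g μ) (h : μ[g | m] =ᵐ[μ] 0) :
    ∫ ω, f ω * g ω ∂μ = 0 := by
  rw [← integral_condExp hm]
  refine integral_eq_zero_of_ae ?_
  filter_upwards [condExp_mul_of_stronglyMeasurable_left hf hfg hg, h] with ω hω hgω
  exact hω.trans (by simp [hgω])

variable {S G : Type*} [Fintype S] {P : G → Matrix S S ℝ} {X : ℕ → Ω → S} {Γ : ℕ → Ω → G}
  {ℱ : Filtration ℕ mΩ}

/-- Conditionally on the past `ℱ n`, the position `X (n + 1)` has law `P (Γ n) (X n) ·`. The test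
functions may depend on the present position and parameter. -/
def IsDrivenBy (P : G → Matrix S S ℝ) (X : ℕ → Ω → S) (Γ : ℕ → Ω → G) (ℱ : Filtration ℕ mΩ)
    (μ : Measure Ω) (n : ℕ) : Prop :=
  ∀ v : S → G → S → ℝ, μ[fun ω => v (X n ω) (Γ n ω) (X (n + 1) ω) | ℱ n]
    =ᵐ[μ] fun ω => (P (Γ n ω) *ᵥ v (X n ω) (Γ n ω)) (X n ω)

lemma IsDrivenBy.integral_eq [IsFiniteMeasure μ] {n : ℕ} (h : IsDrivenBy P X Γ ℱ μ n)
    (v : S → G → S → ℝ) :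
    ∫ ω, v (X n ω) (Γ n ω) (X (n + 1) ω) ∂μ
      = ∫ ω, (P (Γ n ω) *ᵥ v (X n ω) (Γ n ω)) (X n ω) ∂μ := by
  rw [← integral_condExp (ℱ.le n)]
  exact integral_congr_ae (h v)

section Blocks

variable [DecidableEq S] [IsFiniteMeasure μ]

lemma integral_block_eq {a L : ℕ}
    (hdriven : ∀ n ∈ Set.Ico a (a + L), IsDrivenBy P X Γ ℱ μ n)
    (hkept : ∀ n ∈ Set.Ico a (a + L), ∀ᵐ ω ∂μ, Γ (n + 1) ω = Γ n ω) (v : G → S → ℝ) :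
    ∫ ω, v (Γ (a + L) ω) (X (a + L) ω) ∂μ
      = ∫ ω, (P (Γ a ω) ^ L *ᵥ v (Γ a ω)) (X a ω) ∂μ := by
  induction L generalizing v with
  | zero => simp
  | succ L ih =>
    have hsub : Set.Ico a (a + L) ⊆ Set.Ico a (a + (L + 1)) := Set.Ico_subset_Ico_right (by omega)
    have hlast : a + L ∈ Set.Ico a (a + (L + 1)) := ⟨by omega, by omega⟩
    calc ∫ ω, v (Γ (a + L + 1) ω) (X (a + L + 1) ω) ∂μ
        = ∫ ω, v (Γ (a + L) ω) (X (a + L + 1) ω) ∂μ :=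
          integral_congr_ae ((hkept _ hlast).mono fun ω hω => by simp only [hω])
      _ = ∫ ω, (P (Γ (a + L) ω) *ᵥ v (Γ (a + L) ω)) (X (a + L) ω) ∂μ :=
          (hdriven _ hlast).integral_eq fun _ => v
      _ = ∫ ω, (P (Γ a ω) ^ (L + 1) *ᵥ v (Γ a ω)) (X a ω) ∂μ := by
          rw [ih (fun n hn => hdriven n (hsub hn)) (fun n hn => hkept n (hsub hn))
            fun g => P g *ᵥ v g]
          simp only [mulVec_mulVec, pow_succ]

end Blocks

section Limits

variable [MeasurableSpace S] [MeasurableSingletonClass S] [Finite G] [MeasurableSpace G]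
  [MeasurableSingletonClass G] [DecidableEq S] {w : S → ℝ}

/-- Along a long stretch of time during which the parameter is frozen, the chain equilibrates, so
limiting expectations are bounded below by the worst stationary mean. -/
theorem le_of_tendsto_integral_blocks [IsProbabilityMeasure μ]
    (hP : ∀ g, P g ∈ rowStochastic ℝ S) (hprim : ∀ g, (P g).IsPrimitive)
    (hw : w ∈ stdSimplex ℝ S) (hwP : ∀ g, w ᵥ* P g = w) (hX : ∀ n, Measurable (X n))
    (hΓ : ∀ n, Measurable (Γ n)) {a L : ℕ → ℕ} (hL : Tendsto L atTop atTop)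
    (hdriven : ∀ k, ∀ n ∈ Set.Ico (a k) (a k + L k), IsDrivenBy P X Γ ℱ μ n)
    (hkept : ∀ k, ∀ n ∈ Set.Ico (a k) (a k + L k), ∀ᵐ ω ∂μ, Γ (n + 1) ω = Γ n ω)
    {v : G → S → ℝ} {m c : ℝ} (hm : ∀ g, m ≤ w ⬝ᵥ v g)
    (hlim : Tendsto (fun k => ∫ ω, v (Γ (a k + L k) ω) (X (a k + L k) ω) ∂μ) atTop (𝓝 c)) :
    m ≤ c := by
  refine le_of_forall_sub_le fun η hη => ge_of_tendsto hlim ?_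
  have hmix : ∀ᶠ n in atTop, ∀ g x, m - η ≤ (P g ^ n *ᵥ v g) x := by
    refine eventually_all.2 fun g => eventually_all.2 fun x => ?_
    exact (tendsto_pi_nhds.1 (tendsto_pow_mulVec (hP g) (hprim g) hw (hwP g) (v g)) x)
      |>.eventually_const_le (by linarith [hm g])
  filter_upwards [hL.eventually hmix] with k hk
  rw [integral_block_eq (hdriven k) (hkept k)]
  calc m - η = ∫ _, m - η ∂μ := by simp
    _ ≤ ∫ ω, (P (Γ (a k) ω) ^ L k *ᵥ v (Γ (a k) ω)) (X (a k) ω) ∂μ := by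
        refine integral_mono (integrable_const _) ?_ fun ω => hk _ _
        exact (Integrable.of_finite (μ := μ.map fun ω => (Γ (a k) ω, X (a k) ω))
          (f := fun z : G × S => (P z.1 ^ L k *ᵥ v z.1) z.2)).comp_measurable
          ((hΓ _).prodMk (hX _))

end Limits

/-- The martingale increment `u (X (n + 1)) - E[u (X (n + 1)) | ℱ n]` of a driven chain, where the
function `u` depends on the parameter in force. -/
noncomputable def drivenIncrement (P : G → Matrix S S ℝ) (X : ℕ → Ω → S) (Γ : ℕ → Ω → G)
    (u : G → S → ℝ) (n : ℕ) (ω : Ω) : ℝ :=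
  u (Γ n ω) (X (n + 1) ω) - (P (Γ n ω) *ᵥ u (Γ n ω)) (X n ω)

lemma IsDrivenBy.condExp_drivenIncrement [DecidableEq S] (hP : ∀ g, P g ∈ rowStochastic ℝ S)
    {n : ℕ} (h : IsDrivenBy P X Γ ℱ μ n) (u : G → S → ℝ) :
    μ[drivenIncrement P X Γ u n | ℱ n] =ᵐ[μ] 0 := by
  refine (h fun x g y => u g y - (P g *ᵥ u g) x).trans (Eventually.of_forall fun ω => ?_)
  change (P (Γ n ω) *ᵥ (u (Γ n ω) - fun _ => (P (Γ n ω) *ᵥ u (Γ n ω)) (X n ω))) (X n ω) = 0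
  rw [mulVec_sub, mulVec_const_of_mem_rowStochastic (hP _), Pi.sub_apply, sub_self]

variable [Finite G]

lemma exists_abs_drivenIncrement_le (P : G → Matrix S S ℝ) (X : ℕ → Ω → S) (Γ : ℕ → Ω → G)
    (u : G → S → ℝ) : ∃ C, ∀ n ω, |drivenIncrement P X Γ u n ω| ≤ C := by
  obtain ⟨C, hC⟩ := Finite.exists_le fun z : G × S × S => |u z.1 z.2.1 - (P z.1 *ᵥ u z.1) z.2.2|
  exact ⟨C, fun n ω => hC (Γ n ω, X (n + 1) ω, X n ω)⟩

variable [MeasurableSpace S] [MeasurableSingletonClass S] [MeasurableSpace G]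
  [MeasurableSingletonClass G]

lemma stronglyMeasurable_drivenIncrement (hX : ∀ n, Measurable[ℱ n] (X n))
    (hΓ : ∀ n, Measurable[ℱ n] (Γ n)) (u : G → S → ℝ) (n : ℕ) :
    StronglyMeasurable[ℱ (n + 1)] (drivenIncrement P X Γ u n) := by
  have hle : ℱ n ≤ ℱ (n + 1) := ℱ.mono n.le_succ
  have hmeas : Measurable[ℱ (n + 1)] fun ω => ((Γ n ω, X n ω), X (n + 1) ω) :=
    (((hΓ n).mono hle le_rfl).prodMk ((hX n).mono hle le_rfl)).prodMk (hX (n + 1))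
  exact ((measurable_of_finite fun z : (G × S) × S =>
    u z.1.1 z.2 - (P z.1.1 *ᵥ u z.1.1) z.1.2).comp hmeas).stronglyMeasurable

variable [DecidableEq S]

lemma integral_drivenIncrement_mul_eq_zero [IsFiniteMeasure μ]
    (hP : ∀ g, P g ∈ rowStochastic ℝ S) (hX : ∀ n, Measurable[ℱ n] (X n))
    (hΓ : ∀ n, Measurable[ℱ n] (Γ n)) (u : G → S → ℝ) {i j : ℕ} (hij : i < j)
    (hj : IsDrivenBy P X Γ ℱ μ j) :
    ∫ ω, drivenIncrement P X Γ u i ω * drivenIncrement P X Γ u j ω ∂μ = 0 := by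
  obtain ⟨C, hC⟩ := exists_abs_drivenIncrement_le P X Γ u
  have hmeas := stronglyMeasurable_drivenIncrement (P := P) hX hΓ u
  have hLp (n : ℕ) : MemLp (drivenIncrement P X Γ u n) 2 μ :=
    MemLp.of_bound ((hmeas n).mono (ℱ.le _)).aestronglyMeasurable C
      (Eventually.of_forall fun ω => hC n ω)
  exact integral_mul_eq_zero_of_condExp_eq_zero (ℱ.le j) ((hmeas i).mono (ℱ.mono hij))
    ((hLp i).integrable_mul (hLp j)) ((hLp j).integrable one_le_two)
    (hj.condExp_drivenIncrement hP u)

lemma ae_tendsto_cesaroMean_drivenIncrement [IsFiniteMeasure μ]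
    (hP : ∀ g, P g ∈ rowStochastic ℝ S) (hX : ∀ n, Measurable[ℱ n] (X n))
    (hΓ : ∀ n, Measurable[ℱ n] (Γ n)) (u : G → S → ℝ) {I : Set ℕ}
    (hdriven : ∀ n ∈ I, IsDrivenBy P X Γ ℱ μ n) :
    ∀ᵐ ω ∂μ, Tendsto (cesaroMean (I.indicator fun i => drivenIncrement P X Γ u i ω)) atTop
      (𝓝 0) := by
  classical
  obtain ⟨C, hC⟩ := exists_abs_drivenIncrement_le P X Γ u
  let d (i : ℕ) (ω : Ω) : ℝ := I.indicator (fun i => drivenIncrement P X Γ u i ω) i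
  have hle (i : ℕ) (ω : Ω) : ‖d i ω‖ ≤ C :=
    (norm_indicator_le_norm_self (fun i => drivenIncrement P X Γ u i ω) i).trans (hC i ω)
  refine ae_tendsto_cesaroMean_of_orthogonal (d := d) (fun i => ?_) hle ?_
  · by_cases hi : i ∈ I
    · simpa only [d, Set.indicator_of_mem hi] using
        ((stronglyMeasurable_drivenIncrement hX hΓ u i).mono (ℱ.le _)).aestronglyMeasurable
    · simpa only [d, Set.indicator_of_notMem hi] using aestronglyMeasurable_const
  · have horth {i j : ℕ} (hij : i < j) : ∫ ω, d i ω * d j ω ∂μ = 0 := by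
      by_cases hi : i ∈ I
      · by_cases hj : j ∈ I
        · simpa only [d, Set.indicator_of_mem hi, Set.indicator_of_mem hj] using
            integral_drivenIncrement_mul_eq_zero hP hX hΓ u hij (hdriven j hj)
        · simp [d, hj]
      · simp [d, hi]
    intro i j hij
    rcases hij.lt_or_gt with h | h
    · exact horth h
    · simpa only [mul_comm] using horth h

/-- With `u` the solution of the Poisson equation of the parameter in force, `f (X i) - w ⬝ᵥ f` is
`u (X i) - u (X (i + 1))` plus a martingale increment. The first part telescopes as long as the
parameter is kept. -/
theorem ae_tendsto_cesaroMean_of_isDrivenBy [IsFiniteMeasure μ]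
    (hP : ∀ g, P g ∈ rowStochastic ℝ S) (hprim : ∀ g, (P g).IsPrimitive) {w : S → ℝ}
    (hw : w ∈ stdSimplex ℝ S) (hwP : ∀ g, w ᵥ* P g = w) (hX : ∀ n, Measurable[ℱ n] (X n))
    (hΓ : ∀ n, Measurable[ℱ n] (Γ n)) {J : Set ℕ} (hJ : HasDensityZero J)
    (hdriven : ∀ n ∉ J, IsDrivenBy P X Γ ℱ μ n)
    (hkept : ∀ n ∉ J, ∀ᵐ ω ∂μ, Γ (n + 1) ω = Γ n ω) (f : S → ℝ) :
    ∀ᵐ ω ∂μ, Tendsto (cesaroMean fun i => f (X i ω)) atTop (𝓝 (w ⬝ᵥ f)) := by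
  choose u hu using fun g => exists_poisson_solution (hP g) (hprim g) hw (hwP g) f
  obtain ⟨A, hA⟩ := Finite.exists_le fun x => |f x - w ⬝ᵥ f|
  obtain ⟨B, hB⟩ := Finite.exists_le fun z : G × S => |u z.1 z.2|
  obtain ⟨E, hE⟩ := exists_abs_drivenIncrement_le P X Γ u
  filter_upwards [ae_tendsto_cesaroMean_drivenIncrement (I := Jᶜ) hP hX hΓ u hdriven,
    ae_all_iff.2 fun n => ae_all_iff.2 fun hn => hkept n hn] with ω hmart hkeep
  suffices hcentred : Tendsto (cesaroMean fun i => f (X i ω) - w ⬝ᵥ f) atTop (𝓝 0) by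
    have hlim := hcentred.add_const (w ⬝ᵥ f)
    rw [zero_add] at hlim
    refine hlim.congr' ((eventually_ne_atTop 0).mono fun N hN => ?_)
    simp only [← cesaroMean_add_const _ _ hN, sub_add_cancel]
  refine hJ.tendsto_cesaroMean_of_eq_sub_succ_add (b := fun i => u (Γ i ω) (X i ω))
    (fun i => hA (X i ω)) (fun i => hB (Γ i ω, X i ω))
    (fun i => (norm_indicator_le_norm_self (fun i => drivenIncrement P X Γ u i ω) i).trans (hE i ω))
    (fun i hi => ?_) hmart
  rw [Set.indicator_of_mem hi, drivenIncrement, hkeep i hi, hu]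
  ring

end DrivenChains

section Trajectories

open Kernel Preorder

variable {X : ℕ → Type*} [∀ n, MeasurableSpace (X n)] (μ₀ : Measure (X 0)) [IsProbabilityMeasure μ₀]
  (κ : (n : ℕ) → Kernel (Π i : Finset.Iic n, X i) (X (n + 1))) [∀ n, IsMarkovKernel (κ n)]

lemma condExp_trajMeasure {n : ℕ} [StandardBorelSpace (X (n + 1))] [Nonempty (X (n + 1))]
    {f : (Π i : Finset.Iic n, X i) × X (n + 1) → ℝ} (hf : StronglyMeasurable f)
    (hint : Integrable (fun ω => f (frestrictLe n ω, ω (n + 1))) (trajMeasure μ₀ κ)) :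
    (trajMeasure μ₀ κ)[fun ω => f (frestrictLe n ω, ω (n + 1)) | Filtration.piLE n]
      =ᵐ[trajMeasure μ₀ κ] fun ω => ∫ t, f (frestrictLe n ω, t) ∂κ n (frestrictLe n ω) := by
  rw [Filtration.piLE_eq_comap_frestrictLe]
  refine (condExp_prod_ae_eq_integral_condDistrib (measurable_frestrictLe n)
    (measurable_pi_apply (n + 1)).aemeasurable hf hint).trans ?_
  filter_upwards [ae_of_ae_map (measurable_frestrictLe n).aemeasurable
    (condDistrib_trajMeasure (μ₀ := μ₀) (κ := κ))]
    with ω hω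
  rw [hω]

lemma ae_trajMeasure_of_forall_ae {n : ℕ} {p : (Π i : Finset.Iic n, X i) → X (n + 1) → Prop}
    (hp : MeasurableSet {z : (Π i : Finset.Iic n, X i) × X (n + 1) | p z.1 z.2})
    (h : ∀ x, ∀ᵐ t ∂κ n x, p x t) :
    ∀ᵐ ω ∂trajMeasure μ₀ κ, p (frestrictLe n ω) (ω (n + 1)) := by
  have hmap : ∀ᵐ z ∂(trajMeasure μ₀ κ).map fun ω => (frestrictLe n ω, ω (n + 1)),
      p z.1 z.2 := by
    rw [← map_frestrictLe_trajMeasure_compProd_eq_map_trajMeasure]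
    exact Measure.ae_compProd_of_ae_ae hp (Eventually.of_forall h)
  exact ae_of_ae_map (by fun_prop) hmap

end Trajectories

section Metropolis

variable {ε : ℝ}

/-- The transition matrix of the Metropolis kernel with parameter `g`. -/
noncomputable def transMatrix (ε : ℝ) (g : Param) : Matrix State State ℝ := of (transProb ε g)

lemma transMatrix_mem_rowStochastic (h : Admissible ε) (g : Param) :
    transMatrix ε g ∈ rowStochastic ℝ State :=
  mem_rowStochastic_iff_sum.2 ⟨transProb_nonneg h g, sum_transProb ε g⟩

lemma weight_mem_stdSimplex (h : Admissible ε) : weight ε ∈ stdSimplex ℝ State :=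
  ⟨fun x => (weight_pos h x).le, sum_weight ε⟩

lemma weight_mul_min_one_div (h : Admissible ε) (x y : State) :
    weight ε x * min 1 (weight ε y / weight ε x) = min (weight ε x) (weight ε y) := by
  rw [mul_min_of_nonneg _ _ (weight_pos h x).le, mul_one, mul_div_cancel₀ _ (weight_pos h x).ne']

lemma weight_mul_transProb_comm (h : Admissible ε) (g : Param) (x y : State) :
    weight ε x * transProb ε g x y = weight ε y * transProb ε g y x := by
  rcases eq_or_ne x y with rfl | hxy
  · rfl
  · simp only [transProb, hxy, hxy.symm, if_false, moveProb]
    rw [mul_left_comm, weight_mul_min_one_div h, mul_left_comm, weight_mul_min_one_div h,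
      min_comm, proposal, proposal, abs_sub_comm]

lemma weight_vecMul_transMatrix (h : Admissible ε) (g : Param) :
    weight ε ᵥ* transMatrix ε g = weight ε :=
  vecMul_eq_self_of_detailedBalance (transMatrix_mem_rowStochastic h g)
    (weight_mul_transProb_comm h g)

lemma transProb_pos_of_proposal_pos (h : Admissible ε) {g : Param} {x y : State} (hxy : y ≠ x)
    (hp : 0 < proposal g (x : ℕ) (y : ℕ)) : 0 < transProb ε g x y := by
  rw [transProb, if_neg hxy, moveProb]
  exact mul_pos hp (lt_min one_pos (div_pos (weight_pos h y) (weight_pos h x)))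

/-- From an end point of the state space every proposal distribution leaves the state space with
positive probability. -/
lemma transProb_self_pos (ε : ℝ) (g : Param) {x : State} (hx : x = 0 ∨ x = 3) :
    0 < transProb ε g x x := by
  have hle : ∑ z ∈ Finset.univ.erase x, moveProb ε g x z ≤
      ∑ z : State, proposal g (x : ℕ) (z : ℕ) :=
    (Finset.sum_le_sum fun z _ => mul_le_of_le_one_right (proposal_nonneg _ _ _) (min_le_left _ _))
      |>.trans (Finset.sum_le_sum_of_subset_of_nonneg (Finset.erase_subset _ _)
        fun z _ _ => proposal_nonneg _ _ _)
  have hlt : ∑ z : State, proposal g (x : ℕ) (z : ℕ) < 1 := by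
    rcases hx with rfl | rfl <;> fin_cases g <;> norm_num [Fin.sum_univ_four, proposal]
  rw [transProb, if_pos rfl]
  linarith

/-- The moves that both Metropolis kernels make with positive probability: to a neighbour, and
staying at an end point. -/
def IsCommonMove (x y : State) : Prop :=
  (x : ℕ) + 1 = y ∨ (y : ℕ) + 1 = x ∨ x = y ∧ (x = 0 ∨ x = 3)

lemma transProb_pos_of_isCommonMove (h : Admissible ε) (g : Param) {x y : State}
    (hxy : IsCommonMove x y) : 0 < transProb ε g x y := by
  have hadj {x y : State} (hxy : |((y : ℕ) : ℤ) - (x : ℕ)| = 1) : 0 < transProb ε g x y := by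
    refine transProb_pos_of_proposal_pos h (fun heq => by simp [heq] at hxy) ?_
    simp only [proposal, hxy, if_true, true_or]
    split_ifs <;> norm_num
  rcases hxy with hsucc | hsucc | ⟨rfl, hx⟩
  · exact hadj (by simp [← hsucc])
  · exact hadj (by simp [← hsucc])
  · exact transProb_self_pos ε g hx

lemma exists_isCommonMove_path (x y : State) :
    ∃ a b, IsCommonMove x a ∧ IsCommonMove a b ∧ IsCommonMove b y := by
  simp only [IsCommonMove]
  decide +revert

lemma isPrimitive_transMatrix (h : Admissible ε) (g : Param) : (transMatrix ε g).IsPrimitive := by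
  have hnonneg : ∀ x y, 0 ≤ transMatrix ε g x y := transProb_nonneg h g
  refine ⟨hnonneg, 3, by norm_num, fun x y => ?_⟩
  obtain ⟨a, b, hxa, hab, hby⟩ := exists_isCommonMove_path x y
  have hmul (i j : State) : 0 ≤ (transMatrix ε g * transMatrix ε g) i j :=
    nonneg_of_mem_rowStochastic
      (mul_mem (transMatrix_mem_rowStochastic h g) (transMatrix_mem_rowStochastic h g))
  rw [pow_three]
  exact mul_apply_pos hnonneg hmul (transProb_pos_of_isCommonMove h g hxa)
    (mul_apply_pos hnonneg hnonneg (transProb_pos_of_isCommonMove h g hab)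
      (transProb_pos_of_isCommonMove h g hby))

instance (h : Admissible ε) : IsProbabilityMeasure (target ε h) :=
  inferInstanceAs (IsProbabilityMeasure (targetPMF ε h).toMeasure)

instance (h : Admissible ε) (g : Param) : IsMarkovKernel (metropolis ε h g) :=
  ⟨fun x => inferInstanceAs (IsProbabilityMeasure (metropolisPMF ε h g x).toMeasure)⟩

lemma massFunction_target (h : Admissible ε) : massFunction (target ε h) = weight ε := by
  ext x
  rw [massFunction, measureReal_def, target,
    PMF.toMeasure_apply_singleton _ _ (measurableSet_singleton x)]
  exact ENNReal.toReal_ofReal (weight_pos h x).le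

lemma massFunction_metropolisPMF (h : Admissible ε) (g : Param) (x : State) :
    massFunction (metropolisPMF ε h g x).toMeasure = transProb ε g x := by
  ext y
  rw [massFunction, measureReal_def, PMF.toMeasure_apply_singleton _ _ (measurableSet_singleton y)]
  exact ENNReal.toReal_ofReal (transProb_nonneg h g x y)

lemma transitionMatrix_metropolis (h : Admissible ε) (g : Param) :
    transitionMatrix (metropolis ε h g) = transMatrix ε g :=
  Matrix.ext fun x => congr_fun (massFunction_metropolisPMF h g x)

lemma target_singleton_ne_zero (h : Admissible ε) (x : State) : target ε h {x} ≠ 0 := by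
  refine (measureReal_ne_zero_iff).1 ?_
  exact (congr_fun (massFunction_target h) x).trans_ne (weight_pos h x).ne'

theorem regularAndSmallSet_metropolis (h : Admissible ε) :
    RegularAndSmallSet (target ε h) (metropolis ε h) {3} := by
  have hself (g : Param) : 0 < transitionMatrix (metropolis ε h g) 3 3 := by
    rw [transitionMatrix_metropolis]
    exact transProb_self_pos ε g (Or.inr rfl)
  refine ⟨fun g => invariant_of_massFunction_vecMul ?_,
    fun g => isIrreducible_of_transitionMatrix ?_ _,
    fun g => isAperiodic_of_transitionMatrix_self_pos (target_singleton_ne_zero h 3) (hself g),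
    simultaneousMinorisation_singleton (target_singleton_ne_zero h 3) hself⟩
  · rw [transitionMatrix_metropolis, massFunction_target, weight_vecMul_transMatrix h]
  · rw [transitionMatrix_metropolis]
    exact (isPrimitive_transMatrix h g).isIrreducible

theorem simultaneousGeometricDrift_metropolis (h : Admissible ε) :
    SimultaneousGeometricDrift (metropolis ε h) {3} := by
  refine simultaneousGeometricDrift_of_rank (fun x : State => 3 - (x : ℕ)) fun g x hx => ?_
  obtain ⟨y, hy⟩ : ∃ y : State, (x : ℕ) + 1 = y := by
    revert hx
    fin_cases x <;> decide
  refine ⟨y, by omega, ?_⟩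
  rw [transitionMatrix_metropolis]
  exact transProb_pos_of_isCommonMove h g (Or.inl hy)

end Metropolis

section AdaptiveChain

variable {ε : ℝ}

/-- The times `n` such that the parameter is updated right after the draw of `X (n + 1)`. -/
def IsUpdateTime (n : ℕ) : Prop := ∃ k : ℕ, 1 ≤ k ∧ n = 2 ^ k ^ 2

/-- The parameter used to draw `X (n + 1)`. -/
def param (n : ℕ) (ω : ℕ → State × Param) : Param := (ω n).2

open Classical in
/-- The parameter in force after the move at time `n` from the pair `s` to the point `y`. -/
noncomputable def nextParam (n : ℕ) (s : State × Param) (y : State) : Param :=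
  if IsUpdateTime n then adapt s.2 s.1 y else s.2

instance (h : Admissible ε) : IsProbabilityMeasure (chainLaw ε h) :=
  inferInstanceAs (IsProbabilityMeasure (Kernel.trajMeasure _ _))

lemma measurable_apply_piLE {E : Type*} [MeasurableSpace E] (n : ℕ) :
    Measurable[Filtration.piLE (X := fun _ => E) n] fun ω : ℕ → E => ω n := by
  rw [Filtration.piLE_eq_comap_frestrictLe]
  exact (measurable_pi_apply (⟨n, Finset.mem_Iic.2 le_rfl⟩ : Finset.Iic n)).comp
    (comap_measurable (Preorder.frestrictLe (π := fun _ => E) n))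

lemma measurable_chain (n : ℕ) : Measurable[Filtration.piLE n] (chain n) :=
  measurable_fst.comp (measurable_apply_piLE n)

lemma measurable_param (n : ℕ) : Measurable[Filtration.piLE n] (param n) :=
  measurable_snd.comp (measurable_apply_piLE n)

lemma integrable_comp_param_chain (h : Admissible ε) (n : ℕ) (v : Param → State → ℝ) :
    Integrable (fun ω => v (param n ω) (chain n ω)) (chainLaw ε h) :=
  (Integrable.of_finite (f := fun s : State × Param => v s.2 s.1)).comp_measurable
    (measurable_pi_apply n)

lemma stepKernel_apply (h : Admissible ε) {n : ℕ} (hn : 2 ≤ n)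
    (p : Finset.Iic n → State × Param) {s : State × Param}
    (hs : p ⟨n, Finset.mem_Iic.2 le_rfl⟩ = s) :
    stepKernel ε h n p
      = (metropolisPMF ε h s.2 s.1).toMeasure.map fun y => (y, nextParam n s y) := by
  change (stepPMF ε h n (p ⟨n, Finset.mem_Iic.2 le_rfl⟩)).toMeasure = _
  rw [hs, stepPMF, if_neg (by omega), ← PMF.toMeasure_map _ _ (measurable_of_finite _)]
  rfl

lemma isDrivenBy_chain (h : Admissible ε) {n : ℕ} (hn : 2 ≤ n) :
    IsDrivenBy (transMatrix ε) chain param Filtration.piLE (chainLaw ε h) n := by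
  intro v
  let last (p : Finset.Iic n → State × Param) : State × Param := p ⟨n, Finset.mem_Iic.2 le_rfl⟩
  let f (z : (Finset.Iic n → State × Param) × (State × Param)) : ℝ :=
    v (last z.1).1 (last z.1).2 z.2.1
  have hf : StronglyMeasurable f := (measurable_of_finite f).stronglyMeasurable
  have hint : Integrable (fun ω => f (Preorder.frestrictLe n ω, ω (n + 1))) (chainLaw ε h) :=
    (integrable_map_measure hf.aestronglyMeasurable (by fun_prop)).1
      (Integrable.of_finite (f := f) (μ := (chainLaw ε h).map
        fun ω => (Preorder.frestrictLe n ω, ω (n + 1))))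
  have hmean (x : Finset.Iic n → State × Param) : ∫ t, f (x, t) ∂stepKernel ε h n x
      = (transMatrix ε (last x).2 *ᵥ v (last x).1 (last x).2) (last x).1 := by
    rw [stepKernel_apply h hn x rfl, integral_map (measurable_of_finite _).aemeasurable
      (measurable_of_finite _).aestronglyMeasurable, integral_eq_massFunction_dotProduct,
      massFunction_metropolisPMF]
    rfl
  exact (condExp_trajMeasure (X := fun _ => State × Param) (Measure.dirac (0, 0))
    (stepKernel ε h) (n := n) hf hint).trans (Eventually.of_forall fun ω => hmean _)

lemma ae_param_succ (h : Admissible ε) {n : ℕ} (hn : 2 ≤ n) :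
    ∀ᵐ ω ∂chainLaw ε h, param (n + 1) ω = nextParam n (ω n) (chain (n + 1) ω) := by
  let p (x : Finset.Iic n → State × Param) (t : State × Param) : Prop :=
    t.2 = nextParam n (x ⟨n, Finset.mem_Iic.2 le_rfl⟩) t.1
  refine ae_trajMeasure_of_forall_ae (X := fun _ => State × Param) (Measure.dirac (0, 0))
    (stepKernel ε h) (n := n) (p := p) (Set.toFinite _).measurableSet fun x => ?_
  rw [stepKernel_apply h hn x rfl, ae_map_iff (measurable_of_finite _).aemeasurable
    (Set.toFinite _).measurableSet]
  exact Eventually.of_forall fun y => rfl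

lemma ae_param_succ_of_isUpdateTime (h : Admissible ε) {n : ℕ} (hn : 2 ≤ n) (hu : IsUpdateTime n) :
    ∀ᵐ ω ∂chainLaw ε h, param (n + 1) ω = adapt (param n ω) (chain n ω) (chain (n + 1) ω) :=
  (ae_param_succ h hn).mono fun _ hω => hω.trans (if_pos hu)

lemma ae_param_succ_of_not_isUpdateTime (h : Admissible ε) {n : ℕ} (hn : 2 ≤ n)
    (hu : ¬IsUpdateTime n) : ∀ᵐ ω ∂chainLaw ε h, param (n + 1) ω = param n ω :=
  (ae_param_succ h hn).mono fun _ hω => hω.trans (if_neg hu)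

/-- The times at which the chain does not move with a kept parameter: the first two, at which it
stays put, and the update times. -/
def exceptionalTimes : Set ℕ := Set.Iio 2 ∪ Set.range fun k => 2 ^ k ^ 2

lemma hasDensityZero_exceptionalTimes : HasDensityZero exceptionalTimes :=
  (hasDensityZero_Iio 2).union (hasDensityZero_range_of_sq_le fun _ => Nat.lt_two_pow_self.le)

theorem ae_tendsto_cesaroMean_chain (h : Admissible ε) (f : State → ℝ) :
    ∀ᵐ ω ∂chainLaw ε h,
      Tendsto (cesaroMean fun i => f (chain i ω)) atTop (𝓝 (∫ x, f x ∂target ε h)) := by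
  rw [integral_eq_massFunction_dotProduct, massFunction_target]
  have htwo {n : ℕ} (hn : n ∉ exceptionalTimes) : 2 ≤ n := not_lt.1 fun hlt => hn (Or.inl hlt)
  refine ae_tendsto_cesaroMean_of_isDrivenBy (transMatrix_mem_rowStochastic h)
    (isPrimitive_transMatrix h) (weight_mem_stdSimplex h) (weight_vecMul_transMatrix h)
    measurable_chain measurable_param hasDensityZero_exceptionalTimes
    (fun n hn => isDrivenBy_chain h (htwo hn))
    (fun n hn => ae_param_succ_of_not_isUpdateTime h (htwo hn) ?_) f
  rintro ⟨k, -, rfl⟩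
  exact hn (Or.inr ⟨k, rfl⟩)

end AdaptiveChain

section NonConvergence

lemma tendsto_integral_comp_of_tendsto_preimage {S Ω : Type*} [Finite S] [MeasurableSpace S]
    [MeasurableSingletonClass S] {mΩ : MeasurableSpace Ω} {μ : Measure Ω} [IsFiniteMeasure μ]
    {X : ℕ → Ω → S} (hX : ∀ n, Measurable (X n)) {ν : Measure S} [IsFiniteMeasure ν]
    (hν : ∀ A, MeasurableSet A → Tendsto (fun n => μ (X n ⁻¹' A)) atTop (𝓝 (ν A))) (f : S → ℝ) :
    Tendsto (fun n => ∫ ω, f (X n ω) ∂μ) atTop (𝓝 (∫ x, f x ∂ν)) := by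
  cases nonempty_fintype S
  have hmap (n : ℕ) : ∫ ω, f (X n ω) ∂μ = massFunction (μ.map (X n)) ⬝ᵥ f := by
    rw [← integral_eq_massFunction_dotProduct, integral_map (hX n).aemeasurable
      (measurable_of_finite f).aestronglyMeasurable]
  simp only [hmap, integral_eq_massFunction_dotProduct]
  refine tendsto_finsetSum _ fun x _ => Tendsto.mul_const _ ?_
  simp only [massFunction, measureReal_def, Measure.map_apply (hX _) (measurableSet_singleton x)]
  exact (ENNReal.tendsto_toReal (measure_ne_top ν _)).comp (hν {x} (measurableSet_singleton x))

variable {ε : ℝ}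

/-- The probability that the chain is at the point `1` two steps after an update time at which it is
at `x` with parameter `g`: the first step uses `g`, the second one the adapted parameter. -/
noncomputable def twoStepReturn (ε : ℝ) (g : Param) (x : State) : ℝ :=
  (transMatrix ε g *ᵥ fun y => transProb ε (adapt g x y) y 0) x

lemma integral_comp_two_add_of_isUpdateTime (h : Admissible ε) {n : ℕ} (hn : 2 ≤ n)
    (hu : IsUpdateTime n) :
    ∫ ω, Pi.single (M := fun _ => ℝ) 0 1 (chain (n + 2) ω) ∂chainLaw ε h
      = ∫ ω, twoStepReturn ε (param n ω) (chain n ω) ∂chainLaw ε h :=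
  calc ∫ ω, Pi.single (M := fun _ => ℝ) 0 1 (chain (n + 2) ω) ∂chainLaw ε h
      = ∫ ω, transProb ε (param (n + 1) ω) (chain (n + 1) ω) 0 ∂chainLaw ε h := by
        rw [(isDrivenBy_chain h (n := n + 1) (by omega)).integral_eq fun _ _ => Pi.single 0 1]
        simp only [mulVec_single_one]
        rfl
    _ = ∫ ω, transProb ε (adapt (param n ω) (chain n ω) (chain (n + 1) ω)) (chain (n + 1) ω) 0
          ∂chainLaw ε h :=
        integral_congr_ae ((ae_param_succ_of_isUpdateTime h hn hu).mono fun _ hω => by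
          simp only [hω])
    _ = ∫ ω, twoStepReturn ε (param n ω) (chain n ω) ∂chainLaw ε h :=
        (isDrivenBy_chain h hn).integral_eq fun x g y => transProb ε (adapt g x y) y 0

section StationaryMean

lemma weight_dotProduct_mulVec_transProb (h : Admissible ε) (g g' : Param) (y : State) :
    weight ε ⬝ᵥ (transMatrix ε g *ᵥ fun x => transProb ε g' x y) = weight ε y := by
  rw [dotProduct_mulVec, weight_vecMul_transMatrix h]
  exact congr_fun (weight_vecMul_transMatrix h g') y

lemma twoStepReturn_zero (ε : ℝ) : twoStepReturn ε 0 =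
    (transMatrix ε 0 *ᵥ fun y => transProb ε 1 y 0)
      + fun x => transProb ε 0 x x * (transProb ε 0 x 0 - transProb ε 1 x 0) := by
  ext x
  have hadapt (y : State) : transProb ε (adapt 0 x y) y 0 = transProb ε 1 y 0
      + if x = y then transProb ε 0 y 0 - transProb ε 1 y 0 else 0 := by
    rcases eq_or_ne x y with rfl | hxy
    · simp [adapt]
    · simp [adapt, hxy, hxy.symm]
  simp [twoStepReturn, hadapt, mulVec, dotProduct, mul_add, Finset.sum_add_distrib, transMatrix]

lemma twoStepReturn_one (ε : ℝ) : twoStepReturn ε 1 =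
    (transMatrix ε 1 *ᵥ fun y => transProb ε 1 y 0)
      + fun x => transProb ε 1 x 0 * (transProb ε 0 0 0 - transProb ε 1 0 0) := by
  ext x
  have hadapt (y : State) : transProb ε (adapt 1 x y) y 0 = transProb ε 1 y 0
      + if y = 0 then transProb ε 0 y 0 - transProb ε 1 y 0 else 0 := by
    rcases eq_or_ne y 0 with rfl | hy
    · simp [adapt]
    · simp [adapt, hy]
  simp [twoStepReturn, hadapt, mulVec, dotProduct, mul_add, Finset.sum_add_distrib, transMatrix]

lemma weight_dotProduct_twoStepReturn_zero (h : Admissible ε) :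
    weight ε ⬝ᵥ twoStepReturn ε 0
      = ε + ε * ∑ x, transProb ε 0 x x * (transProb ε 0 0 x - transProb ε 1 0 x) := by
  rw [twoStepReturn_zero, dotProduct_add, weight_dotProduct_mulVec_transProb h, Finset.mul_sum]
  refine congrArg (ε + ·) (Finset.sum_congr rfl fun x _ => ?_)
  have hcomm (g : Param) : weight ε x * transProb ε g x 0 = ε * transProb ε g 0 x :=
    weight_mul_transProb_comm h g x 0
  linear_combination transProb ε 0 x x * (hcomm 0 - hcomm 1)

lemma weight_dotProduct_twoStepReturn_one (h : Admissible ε) :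
    weight ε ⬝ᵥ twoStepReturn ε 1 = ε + ε * (transProb ε 0 0 0 - transProb ε 1 0 0) := by
  have hreturn : ∑ x, weight ε x * transProb ε 1 x 0 = ε :=
    congr_fun (weight_vecMul_transMatrix h 1) 0
  rw [twoStepReturn_one, dotProduct_add, weight_dotProduct_mulVec_transProb h]
  simp only [dotProduct, ← mul_assoc, ← Finset.sum_mul, hreturn]
  rfl

lemma transProb_self (ε : ℝ) (g : Param) (x : State) :
    transProb ε g x x = 1 - ∑ y, moveProb ε g x y := by
  have hself : moveProb ε g x x = 0 := by simp [moveProb, proposal]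
  rw [transProb, if_pos rfl, ← Finset.add_sum_erase _ _ (Finset.mem_univ x), hself, zero_add]

lemma min_one_weight_one_div_weight_zero (h : Admissible ε) :
    min 1 (weight ε 1 / weight ε 0) = ε ^ 2 := by
  have hpos := h.pos
  have hratio : weight ε 1 / weight ε 0 = ε ^ 2 := by
    simp only [weight, cons_val]
    field_simp
  rw [hratio, min_eq_right]
  nlinarith [h.lt_one, pow_pos hpos 3]

lemma transProb_zero_zero (h : Admissible ε) :
    transProb ε 0 0 = ![1 - ε ^ 2 / 2, ε ^ 2 / 2, 0, 0] := by
  ext x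
  fin_cases x
  · norm_num [transProb_self, Fin.sum_univ_four, moveProb, proposal,
      min_one_weight_one_div_weight_zero h]
    ring
  all_goals norm_num [transProb, moveProb, proposal, min_one_weight_one_div_weight_zero h]
  ring

lemma transProb_one_zero (h : Admissible ε) (hε : ε < 1 / 4) :
    transProb ε 1 0 = ![3 / 4 - ε ^ 2 / 4, ε ^ 2 / 4, 1 / 4, 0] := by
  have hmin : min 1 (weight ε 2 / weight ε 0) = 1 := by
    refine min_eq_left ((one_le_div (weight_pos h 0)).2 ?_)
    have hcube : ε ^ 3 < (1 / 4) ^ 3 := pow_lt_pow_left₀ hε h.pos.le three_ne_zero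
    simp only [weight, cons_val]
    linarith
  ext x
  fin_cases x
  · norm_num [transProb_self, Fin.sum_univ_four, moveProb, proposal,
      min_one_weight_one_div_weight_zero h, hmin]
    ring
  all_goals simp [transProb, moveProb, proposal, min_one_weight_one_div_weight_zero h, hmin]
  ring

lemma transProb_zero_two_two_le (h : Admissible ε) : transProb ε 0 2 2 ≤ 1 / 2 := by
  have hmove : transProb ε 0 2 3 = 1 / 2 := by
    have hratio : weight ε 3 / weight ε 2 = 1 := div_self (weight_pos h 2).ne'
    rw [transProb, if_neg (by decide), moveProb, hratio]
    norm_num [proposal]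
  have hsum := sum_transProb ε 0 2
  rw [Fin.sum_univ_four, hmove] at hsum
  linarith [transProb_nonneg h 0 2 0, transProb_nonneg h 0 2 1]

lemma lt_weight_dotProduct_twoStepReturn (h : Admissible ε) (hε : ε < 1 / 4) (g : Param) :
    ε < weight ε ⬝ᵥ twoStepReturn ε g := by
  have hpos := h.pos
  have hsq : ε ^ 2 < 1 / 16 := by nlinarith
  fin_cases g
  · have h1 : 0 ≤ transProb ε 0 1 1 * (ε ^ 2 / 4) :=
      mul_nonneg (transProb_nonneg h 0 1 1) (by positivity)
    have h2 := transProb_zero_two_two_le h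
    have hgain : 0 < ∑ x, transProb ε 0 x x * (transProb ε 0 0 x - transProb ε 1 0 x) := by
      simp only [Fin.sum_univ_four, transProb_zero_zero h, transProb_one_zero h hε, cons_val]
      nlinarith
    exact (lt_add_of_pos_right ε (mul_pos hpos hgain)).trans_eq
      (weight_dotProduct_twoStepReturn_zero h).symm
  · have hgain : 0 < transProb ε 0 0 0 - transProb ε 1 0 0 := by
      simp only [transProb_zero_zero h, transProb_one_zero h hε, cons_val]
      linarith
    exact (lt_add_of_pos_right ε (mul_pos hpos hgain)).trans_eq
      (weight_dotProduct_twoStepReturn_one h).symm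

end StationaryMean

section UpdateTimes

lemma two_pow_sq_add_le (k : ℕ) : 2 ^ k ^ 2 + 1 + k ≤ 2 ^ (k + 1) ^ 2 := by
  have hpow : 2 * k + 1 < 2 ^ (2 * k + 1) := Nat.lt_two_pow_self
  have hone : 1 ≤ 2 ^ k ^ 2 := Nat.one_le_two_pow
  calc 2 ^ k ^ 2 + 1 + k ≤ 2 ^ k ^ 2 * 2 ^ (2 * k + 1) := by nlinarith
    _ = 2 ^ (k + 1) ^ 2 := by ring

lemma not_isUpdateTime_of_mem_Ioo {k n : ℕ} (hn : n ∈ Set.Ioo (2 ^ k ^ 2) (2 ^ (k + 1) ^ 2)) :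
    ¬IsUpdateTime n := by
  rintro ⟨j, -, rfl⟩
  have hmono : StrictMono fun k : ℕ => 2 ^ k ^ 2 :=
    (pow_right_strictMono₀ one_lt_two).comp (Nat.pow_left_strictMono two_ne_zero)
  have hkj : k < j := hmono.lt_iff_lt.1 hn.1
  have hjk : j < k + 1 := hmono.lt_iff_lt.1 hn.2
  omega

lemma le_of_tendsto_integral_updateTimes (h : Admissible ε) {v : Param → State → ℝ} {m c : ℝ}
    (hm : ∀ g, m ≤ weight ε ⬝ᵥ v g)
    (hlim : Tendsto (fun n => ∫ ω, v (param (2 ^ n ^ 2) ω) (chain (2 ^ n ^ 2) ω) ∂chainLaw ε h)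
      atTop (𝓝 c)) : m ≤ c := by
  let a (k : ℕ) : ℕ := 2 ^ (k + 1) ^ 2 + 1
  let L (k : ℕ) : ℕ := 2 ^ (k + 2) ^ 2 - a k
  have hgap (k : ℕ) : a k + (k + 1) ≤ 2 ^ (k + 2) ^ 2 := two_pow_sq_add_le (k + 1)
  have hend (k : ℕ) : a k + L k = 2 ^ (k + 2) ^ 2 := Nat.add_sub_cancel' (by have := hgap k; omega)
  have hL : Tendsto L atTop atTop := tendsto_atTop_mono
    (fun k => show k ≤ L k by have := hgap k; have := hend k; omega) tendsto_id
  have htwo {k n : ℕ} (hn : n ∈ Set.Ico (a k) (a k + L k)) : 2 ≤ n :=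
    (Nat.succ_le_succ Nat.one_le_two_pow).trans hn.1
  refine le_of_tendsto_integral_blocks (transMatrix_mem_rowStochastic h)
    (isPrimitive_transMatrix h) (weight_mem_stdSimplex h) (weight_vecMul_transMatrix h)
    (fun n => (measurable_chain n).mono (Filtration.le _ n) le_rfl)
    (fun n => (measurable_param n).mono (Filtration.le _ n) le_rfl) hL
    (fun k n hn => isDrivenBy_chain h (htwo hn))
    (fun k n hn => ae_param_succ_of_not_isUpdateTime h (htwo hn) ?_) hm ?_
  · exact not_isUpdateTime_of_mem_Ioo (k := k + 1) ⟨hn.1, hn.2.trans_eq (hend k)⟩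
  · simpa only [hend, Function.comp_def] using hlim.comp (tendsto_add_atTop_nat 2)

end UpdateTimes

theorem not_convergesInDistribution_chain (h : Admissible ε) (hε : ε < 1 / 4) :
    ¬ConvergesInDistribution (chainLaw ε h) chain := by
  rintro ⟨ν, hν, hconv⟩
  let p : ℝ := ∫ x, Pi.single (M := fun _ => ℝ) 0 1 x ∂ν
  have hat : Tendsto (fun n => ∫ ω, Pi.single (M := fun _ => ℝ) 0 1 (chain n ω) ∂chainLaw ε h)
      atTop (𝓝 p) :=
    tendsto_integral_comp_of_tendsto_preimage
      (fun n => (measurable_chain n).mono (Filtration.le _ n) le_rfl) hconv _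
  have hupdate : Tendsto (fun k : ℕ => 2 ^ k ^ 2) atTop atTop :=
    (tendsto_pow_atTop_atTop_of_one_lt one_lt_two).comp (tendsto_pow_atTop two_ne_zero)
  have hafter : Tendsto (fun k : ℕ => ∫ ω, twoStepReturn ε (param (2 ^ k ^ 2) ω)
      (chain (2 ^ k ^ 2) ω) ∂chainLaw ε h) atTop (𝓝 p) := by
    refine (hat.comp ((tendsto_add_atTop_nat 2).comp hupdate)).congr' ?_
    filter_upwards [eventually_ge_atTop 1] with k hk
    exact integral_comp_two_add_of_isUpdateTime h
      (le_self_pow₀ one_le_two (pow_ne_zero 2 (by omega))) ⟨k, hk, rfl⟩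
  obtain ⟨g, hg⟩ := Finite.exists_min fun g => weight ε ⬝ᵥ twoStepReturn ε g
  have hle : weight ε ⬝ᵥ twoStepReturn ε g - ε ≤ p - p := by
    refine le_of_tendsto_integral_updateTimes h
      (v := fun g x => twoStepReturn ε g x - Pi.single (M := fun _ => ℝ) 0 1 x) (fun g' => ?_)
      ((hafter.sub (hat.comp hupdate)).congr fun k => ?_)
    · change _ ≤ weight ε ⬝ᵥ (twoStepReturn ε g' - Pi.single 0 1)
      rw [dotProduct_sub, dotProduct_single_one]
      exact sub_le_sub_right (hg g') ε
    · exact (integral_sub (integrable_comp_param_chain h _ (twoStepReturn ε))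
        (integrable_comp_param_chain h _ fun _ => Pi.single 0 1)).symm
  linarith [lt_weight_dotProduct_twoStepReturn h hε g]

end NonConvergence

end AirMCMC

theorem mainTheorem6 :
    (∀ (ε : ℝ) (h : AirMCMC.Admissible ε),
      (∃ C : Set AirMCMC.State,
        AirMCMC.RegularAndSmallSet (AirMCMC.target ε h) (AirMCMC.metropolis ε h) C ∧
        AirMCMC.SimultaneousGeometricDrift (AirMCMC.metropolis ε h) C) ∧
      (∀ f : AirMCMC.State → ℝ,
        ∀ᵐ ω ∂(AirMCMC.chainLaw ε h),
          Tendsto (fun N : ℕ => (1 / (N : ℝ)) * ∑ i ∈ Finset.range N, f (AirMCMC.chain i ω))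
            atTop (𝓝 (∫ x, f x ∂(AirMCMC.target ε h))))) ∧
    (∃ ε₀ : ℝ, 0 < ε₀ ∧ ∀ (ε : ℝ) (h : AirMCMC.Admissible ε), ε < ε₀ →
      ¬ AirMCMC.ConvergesInDistribution (AirMCMC.chainLaw ε h) AirMCMC.chain) := by
  refine ⟨fun ε h => ⟨⟨{3}, AirMCMC.regularAndSmallSet_metropolis h,
    AirMCMC.simultaneousGeometricDrift_metropolis h⟩, AirMCMC.ae_tendsto_cesaroMean_chain h⟩,
    1 / 4, by norm_num, fun ε h hε => AirMCMC.not_convergesInDistribution_chain h hε⟩
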